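/- Let $n\ge 1$, let $\ell\neq p$ be primes and let $\mathbf F$ be a finite field of characteristic $p$. Let $K_\infty$ be a maximal compact subgroup of $\mathrm{GL}_n(\mathbf R)$, with identity component $K_\infty^0$, let $K^\ell$ be a compact open subgroup of $\mathrm{GL}_n(\mathbb A^{\ell,\infty})$, let $K_\ell$ be a compact open subgroup of $\mathrm{GL}_n(\mathbf Z_\ell)$, and put $K=K^\ell K_\ell$. Let $Y(K)=\mathrm{GL}_n(\mathbf Q)\backslash \mathrm{GL}_n(\mathbb A)/K_\infty^0K$, regarded as an orbifold: $H^*(Y(K),\mathbf F)$ is the cohomology of the homotopy quotient of $\mathrm{GL}_n(\mathbb A)/K_\infty^0K$ by $\mathrm{GL}_n(\mathbf Q)$, which is the singular cohomology of $Y(K)$ if $\mathrm{GL}_n(\mathbf Q)$ acts freely. Let $\Pi_{n,\ell}=\varinjlim_{K_\ell}H^d(Y(K^\ell K_\ell),\mathbf F)$, the limit being over all compact open subgroups $K_\ell$ of $\mathrm{GL}_n(\mathbf Z_\ell)$. For $g\in\mathrm{GL}_n(\mathbb A^{\ell,\infty})$ let $T(g)$ be the Hecke operator $H^*(Y(K))\to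 H^*(Y(gKg^{-1}\cap K))\to H^*(Y(K\cap g^{-1}Kg))\to H^*(Y(K))$ (pull-back, right translation by $g^{-1}$, corestriction), and let $\deg T(g)=[K:K\cap g^{-1}Kg]$. For a prime $q\ne\ell$ with $\mathrm{GL}_n(\mathbf Z_q)\subset K^\ell$ and $1\le k\le n$ let $T_{q,k}=T(g)$, where $g$ is the diagonal matrix at the place $q$ with $k$ entries $q$ and $n-k$ entries $1$. Let $\mathbf T$ be the commutative polynomial algebra over $\mathbf F$ in the $T_{q,k}$; it acts on $H^*(Y(K^\ell L_\ell),\mathbf F)$ for all compact open $L_\ell\subset \mathrm{GL}_n(\mathbf Z_\ell)$. Let $A=\mathbf Q_{>0}\backslash\mathbb A^{\infty,\times}/\det(K)$ be the group of connected components of $Y(K)$. For a monomial $T=\prod_j T_{q_j,k_j}$ let $\deg T$ be the product of the degrees, and let $\langle T\rangle\in A$ be the product of the images of the determinants of the corresponding matrices. A maximal ideal $\mathfrak m$ of $\mathbf T$ is called Eisenstein if it contains $T-\deg T$ for every monomial $T$ with $\langle T\rangle=1$. A class $c\in H^d(Y(K),\mathbf F)$ is called Eisenstein if $Tc=\deg(T)\,\langle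 T\rangle c$ for all monomials $T$, where $\langle T\rangle c$ depends only on the image $\langle T\rangle\in A$; precisely, if there is a family $(\langle a\rangle c)_{a\in A}$ of classes with $\langle 1\rangle c=c$ and $T_{q,k}(\langle a\rangle c)=\deg(T_{q,k})\,\langle a\cdot\langle T_{q,k}\rangle\rangle c$ for all $q,k,a$. In particular $Tc=\deg(T)c$ whenever $\langle T\rangle=1$. Let $\mathfrak m$ be a maximal ideal of $\mathbf T$, and suppose that, if $\mathfrak m$ is not Eisenstein, then $H^i(Y(L),\mathbf F)_{\mathfrak m}=0$ for all $i<d$ and all $L=K^\ell L_\ell$ with $L_\ell$ a compact open normal subgroup of $\mathrm{GL}_n(\mathbf Z_\ell)$. Let $c$ be any class in the kernel of $H^d(Y(K),\mathbf F)\to\Pi_{n,\ell}$. Then: 1. if $\mathfrak m$ is not Eisenstein, the image of $c$ in the localisation $H^d(Y(K),\mathbf F)_{\mathfrak m}$ is zero (so the kernel vanishes after localisation at $\mathfrak m$); 2. if $c$ is a Hecke eigenclass belonging to $\mathfrak m$, that is, if $\mathfrak m c=0$, then $c$ is Eisenstein. -/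

import Mathlib

open scoped RestrictedProduct MatrixGroups

noncomputable section

namespace ArithCohomology

/-! ### Adeles and the groups attached to `GL_n` -/

/-- The finite places of `ℚ` different from `ℓ`. -/
abbrev AwayPrime (ℓ : ℕ) : Type := {q : ℕ // q.Prime ∧ q ≠ ℓ}

instance awayPrimeFact (ℓ : ℕ) (q : AwayPrime ℓ) : Fact (q : ℕ).Prime := ⟨q.2.1⟩

/-- The ring `𝔸^{ℓ,∞}`: the restricted product of the `ℚ_q`, `q ≠ ℓ`, with respect to the `ℤ_q`. -/
abbrev AwayAdele (ℓ : ℕ) : Type :=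
  Πʳ q : AwayPrime ℓ, [ℚ_[(q : ℕ)], PadicInt.subring (q : ℕ)]

instance awayIntegersOpen (ℓ : ℕ) :
    Fact (∀ q : AwayPrime ℓ, IsOpen (PadicInt.subring (q : ℕ) : Set ℚ_[(q : ℕ)])) :=
  ⟨fun q => by
    have h : (PadicInt.subring (q : ℕ) : Set ℚ_[(q : ℕ)]) = Metric.closedBall 0 1 := by
      ext x
      simp [PadicInt.subring]
    rw [h]
    exact IsUltrametricDist.isOpen_closedBall _ one_ne_zero⟩

/-- The diagonal embedding `ℚ → 𝔸^{ℓ,∞}`. -/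
def ratToAway (ℓ : ℕ) : ℚ →+* AwayAdele ℓ where
  toFun r := ⟨fun q => (r : ℚ_[(q : ℕ)]), by
    have hfin : {q : AwayPrime ℓ | ¬ ((r : ℚ_[(q : ℕ)]) ∈ PadicInt.subring (q : ℕ))}.Finite := by
      refine Set.Finite.of_finite_image (f := fun q : AwayPrime ℓ => (q : ℕ)) ?_
        (Subtype.val_injective.injOn)
      refine (Set.finite_le_nat r.den).subset ?_
      rintro _ ⟨q, hq, rfl⟩
      by_contra hd
      exact hq (Padic.norm_rat_le_one fun h => hd (Nat.le_of_dvd r.den_pos h))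
    simpa [Filter.eventually_cofinite] using hfin⟩
  map_one' := by ext q; exact Rat.cast_one
  map_mul' a b := by ext q; exact Rat.cast_mul a b
  map_zero' := by ext q; exact Rat.cast_zero
  map_add' a b := by ext q; exact Rat.cast_add a b

/-- `GL_n(𝔸^∞)`, written as `GL_n(𝔸^{ℓ,∞}) × GL_n(ℚ_ℓ)`. -/
abbrev GLFin (n ℓ : ℕ) [Fact ℓ.Prime] : Type :=
  GL (Fin n) (AwayAdele ℓ) × GL (Fin n) ℚ_[ℓ]

/-- The diagonal embedding `GL_n(ℚ) → GL_n(𝔸^∞)`. -/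
def rationalPoints (n ℓ : ℕ) [Fact ℓ.Prime] : GL (Fin n) ℚ →* GLFin n ℓ :=
  (Matrix.GeneralLinearGroup.map (ratToAway ℓ)).prod
    (Matrix.GeneralLinearGroup.map (algebraMap ℚ ℚ_[ℓ]))

/-- The inclusion `GL_n(ℤ_ℓ) → GL_n(ℚ_ℓ)`. -/
def integralPoints (n ℓ : ℕ) [Fact ℓ.Prime] : GL (Fin n) ℤ_[ℓ] →* GL (Fin n) ℚ_[ℓ] :=
  Matrix.GeneralLinearGroup.map (algebraMap ℤ_[ℓ] ℚ_[ℓ])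

/-- A compact open subgroup `K^ℓ` of `GL_n(𝔸^{ℓ,∞})`. -/
structure TameLevel (n ℓ : ℕ) where
  toSubgroup : Subgroup (GL (Fin n) (AwayAdele ℓ))
  isOpen' : IsOpen (toSubgroup : Set (GL (Fin n) (AwayAdele ℓ)))
  isCompact' : IsCompact (toSubgroup : Set (GL (Fin n) (AwayAdele ℓ)))

/-- The level `K = K^ℓ K_ℓ`. The group `GL_n(ℤ_ℓ)` being compact, its compact open subgroups are
its open subgroups. -/
def level {n ℓ : ℕ} [Fact ℓ.Prime] (Kt : TameLevel n ℓ) (Kl : OpenSubgroup (GL (Fin n) ℤ_[ℓ])) :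
    Subgroup (GLFin n ℓ) :=
  Kt.toSubgroup.prod ((Kl : Subgroup (GL (Fin n) ℤ_[ℓ])).map (integralPoints n ℓ))

/-- The identity component `K_∞⁰` of a subgroup `K_∞` of `GL_n(ℝ)`. -/
def identityComponent {n : ℕ} (Kinf : Subgroup (GL (Fin n) ℝ)) : Subgroup (GL (Fin n) ℝ) :=
  (Subgroup.connectedComponentOfOne Kinf).map Kinf.subtype

/-- The space `GL_n(ℝ) / K_∞⁰`. -/
abbrev ArchSpace {n : ℕ} (Kinf : Subgroup (GL (Fin n) ℝ)) : Type :=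
  GL (Fin n) ℝ ⧸ identityComponent Kinf

/-! ### The cohomology of `Y(K)`

`Y(K) = GL_n(ℚ) \ Z(K)`, where `Z(K) = GL_n(𝔸) / K_∞⁰ K` is the product of the space
`GL_n(ℝ) / K_∞⁰` and the discrete set `GL_n(𝔸^∞) / K`. As always for a level that need not be
torsion free, `Y(K)` is an orbifold, and its cohomology is the cohomology of the homotopy quotient
`(EG × Z(K)) / G` with `G = GL_n(ℚ)` (discrete), which is the singular cohomology of the
topological space `Y(K)` as soon as `G` acts freely on `Z(K)`. It is computed here by the simplicial
set `(EG × Sing Z(K)) / G`. An `m`-simplex of `EG × Sing Z(K)` is an `(m+1)`-tuple of elements of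
`G`, a singular `m`-simplex of `GL_n(ℝ) / K_∞⁰` and an element of `GL_n(𝔸^∞) / K` (singular
simplices of a discrete space are constant). -/

section Cohomology

variable {n ℓ : ℕ} [Fact ℓ.Prime] (F : Type*) [Field F] (Kinf : Subgroup (GL (Fin n) ℝ))

/-- Singular `m`-simplices of `GL_n(ℝ) / K_∞⁰`. -/
abbrev Simplex (m : ℕ) : Type := C(stdSimplex ℝ (Fin (m + 1)), ArchSpace Kinf)

variable {Kinf} in
/-- The `i`-th face of a singular simplex. -/
def face {m : ℕ} (i : Fin (m + 2)) (σ : Simplex Kinf (m + 1)) : Simplex Kinf m :=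
  σ.comp ⟨stdSimplex.map i.succAbove, stdSimplex.continuous_map _⟩

variable {Kinf} in
/-- The translate of a singular simplex by a rational matrix. -/
def translate {m : ℕ} (γ : GL (Fin n) ℚ) (σ : Simplex Kinf m) : Simplex Kinf m :=
  (⟨fun x => Matrix.GeneralLinearGroup.map (algebraMap ℚ ℝ) γ • x,
    continuous_const_smul _⟩ : C(ArchSpace Kinf, ArchSpace Kinf)).comp σ

variable (ℓ) in
/-- Functions of a tuple of rational matrices, a simplex and a point of `GL_n(𝔸^∞)`. -/
abbrev PreCochain (m : ℕ) : Type _ :=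
  (Fin (m + 1) → GL (Fin n) ℚ) → Simplex Kinf m → GLFin n ℓ → F

/-- `m`-cochains of `(EG × Sing Z(U)) / G`: functions that are invariant under `G = GL_n(ℚ)` on the
left and under `U` on the right. -/
def Cochain (U : Subgroup (GLFin n ℓ)) (m : ℕ) : Submodule F (PreCochain ℓ F Kinf m) where
  carrier := {f | (∀ γ a σ x,
      f (fun i => γ * a i) (translate γ σ) (rationalPoints n ℓ γ * x) = f a σ x) ∧
    ∀ a σ x, ∀ u ∈ U, f a σ (x * u) = f a σ x}
  zero_mem' := by simp
  add_mem' := by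
    rintro f g ⟨hf, hf'⟩ ⟨hg, hg'⟩
    exact ⟨fun γ a σ x => by simp [hf γ a σ x, hg γ a σ x],
      fun a σ x u hu => by simp [hf' a σ x u hu, hg' a σ x u hu]⟩
  smul_mem' := by
    rintro r f ⟨hf, hf'⟩
    exact ⟨fun γ a σ x => by simp [hf γ a σ x], fun a σ x u hu => by simp [hf' a σ x u hu]⟩

/-- The alternating sum of the faces. -/
def preDiff (m : ℕ) : PreCochain ℓ F Kinf m →ₗ[F] PreCochain ℓ F Kinf (m + 1) where
  toFun f a σ x := ∑ i : Fin (m + 2), (-1 : F) ^ (i : ℕ) * f (a ∘ i.succAbove) (face i σ) x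
  map_add' f g := by
    funext a σ x
    simp [mul_add, Finset.sum_add_distrib]
  map_smul' r f := by
    funext a σ x
    simp [Finset.mul_sum, mul_left_comm]

theorem preDiff_mem {U : Subgroup (GLFin n ℓ)} {m : ℕ} {f : PreCochain ℓ F Kinf m}
    (hf : f ∈ Cochain F Kinf U m) : preDiff F Kinf m f ∈ Cochain F Kinf U (m + 1) := by
  refine ⟨fun γ a σ x => ?_, fun a σ x u hu => ?_⟩
  · change ∑ i : Fin (m + 2), _ = ∑ i : Fin (m + 2), _
    refine Finset.sum_congr rfl fun i _ => congrArg ((-1 : F) ^ (i : ℕ) * ·) ?_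
    exact hf.1 γ (a ∘ i.succAbove) (face i σ) x
  · change ∑ i : Fin (m + 2), _ = ∑ i : Fin (m + 2), _
    refine Finset.sum_congr rfl fun i _ => congrArg ((-1 : F) ^ (i : ℕ) * ·) ?_
    exact hf.2 (a ∘ i.succAbove) (face i σ) x u hu

/-- Cocycles of level `U`. -/
def Cocycle (U : Subgroup (GLFin n ℓ)) (m : ℕ) : Submodule F (PreCochain ℓ F Kinf m) :=
  Cochain F Kinf U m ⊓ LinearMap.ker (preDiff F Kinf m)

/-- Coboundaries of cochains of level `U`. -/
def Coboundary (U : Subgroup (GLFin n ℓ)) : (m : ℕ) → Submodule F (PreCochain ℓ F Kinf m)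
  | 0 => ⊥
  | m + 1 => (Cochain F Kinf U m).map (preDiff F Kinf m)

/-- The cohomology group `H^m(Y(U), F)`. -/
abbrev Coh (U : Subgroup (GLFin n ℓ)) (m : ℕ) : Type _ :=
  Cocycle F Kinf U m ⧸ (Coboundary F Kinf U m).submoduleOf (Cocycle F Kinf U m)

variable {F Kinf} in
/-- The map on cohomology induced by a map of cochain complexes. -/
def cohMap {U V : Subgroup (GLFin n ℓ)}
    (φ : ∀ m, PreCochain ℓ F Kinf m →ₗ[F] PreCochain ℓ F Kinf m)
    (hφ : ∀ m f, preDiff F Kinf m (φ m f) = φ (m + 1) (preDiff F Kinf m f))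
    (hUV : ∀ m, ∀ f ∈ Cochain F Kinf U m, φ m f ∈ Cochain F Kinf V m) (m : ℕ) :
    Coh F Kinf U m →ₗ[F] Coh F Kinf V m :=
  Submodule.mapQ _ _
    ((φ m).restrict (p := Cocycle F Kinf U m) (q := Cocycle F Kinf V m) fun f hf =>
      ⟨hUV m f hf.1, by
        have h0 : preDiff F Kinf m f = 0 := hf.2
        exact (hφ m f).trans (by rw [h0, map_zero])⟩)
    (by
      rintro ⟨f, hf⟩ hb
      change f ∈ Coboundary F Kinf U m at hb
      change φ m f ∈ Coboundary F Kinf V m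
      cases m with
      | zero =>
        have h0 : f = 0 := hb
        rw [h0, map_zero]
        exact Submodule.zero_mem _
      | succ m =>
        obtain ⟨b, hbU, rfl⟩ := hb
        exact ⟨φ m b, hUV m b hbU, hφ m b⟩)

/-- The pull-back map `H^m(Y(U), F) → H^m(Y(V), F)` for `V ≤ U`. -/
def restriction {U V : Subgroup (GLFin n ℓ)} (h : V ≤ U) (m : ℕ) :
    Coh F Kinf U m →ₗ[F] Coh F Kinf V m :=
  cohMap (fun _ => LinearMap.id) (fun _ _ => rfl)
    (fun _ _ hf => ⟨hf.1, fun a σ x u hu => hf.2 a σ x u (h hu)⟩) m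

theorem level_mono (Kt : TameLevel n ℓ) {Ll Kl : OpenSubgroup (GL (Fin n) ℤ_[ℓ])} (h : Ll ≤ Kl) :
    level Kt Ll ≤ level Kt Kl :=
  Subgroup.prod_mono le_rfl (Subgroup.map_mono h)

open Classical in
/-- `Π_{n,ℓ}`, the direct limit of the `H^d(Y(K^ℓ K_ℓ), F)` over the compact open subgroups `K_ℓ` of
`GL_n(ℤ_ℓ)`, ordered by reverse inclusion. -/
abbrev LimitCoh (Kt : TameLevel n ℓ) (d : ℕ) : Type _ :=
  Module.DirectLimit (R := F) (ι := (OpenSubgroup (GL (Fin n) ℤ_[ℓ]))ᵒᵈ)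
    (fun Kl => Coh F Kinf (level Kt (OrderDual.ofDual Kl)) d)
    (fun _ _ h => restriction F Kinf (level_mono Kt (OrderDual.ofDual_le_ofDual.mpr h)) d)

open Classical in
/-- The canonical map `H^d(Y(K), F) → Π_{n,ℓ}`. -/
def toLimit (Kt : TameLevel n ℓ) (Kl : OpenSubgroup (GL (Fin n) ℤ_[ℓ])) (d : ℕ) :
    Coh F Kinf (level Kt Kl) d →ₗ[F] LimitCoh F Kinf Kt d :=
  Module.DirectLimit.of F (OpenSubgroup (GL (Fin n) ℤ_[ℓ]))ᵒᵈ
    (fun Kl => Coh F Kinf (level Kt (OrderDual.ofDual Kl)) d)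
    (fun _ _ h => restriction F Kinf (level_mono Kt (OrderDual.ofDual_le_ofDual.mpr h)) d)
    (OrderDual.toDual Kl)

end Cohomology

/-! ### Hecke operators -/

section Hecke

variable {n ℓ : ℕ}

/-- The subgroup `K^ℓ ∩ g⁻¹ K^ℓ g` of `K^ℓ`. -/
def TameLevel.conjInf (Kt : TameLevel n ℓ) (g : GL (Fin n) (AwayAdele ℓ)) :
    Subgroup Kt.toSubgroup :=
  (Kt.toSubgroup.map (MulAut.conj g⁻¹).toMonoidHom).subgroupOf Kt.toSubgroup

theorem TameLevel.mem_conjInf (Kt : TameLevel n ℓ) (g : GL (Fin n) (AwayAdele ℓ))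
    (k : Kt.toSubgroup) : k ∈ Kt.conjInf g ↔ g * k * g⁻¹ ∈ Kt.toSubgroup := by
  simp only [TameLevel.conjInf, Subgroup.mem_subgroupOf, Subgroup.mem_map]
  constructor
  · rintro ⟨y, hy, h⟩
    rw [← h]
    simpa [mul_assoc] using hy
  · intro h
    exact ⟨_, h, by simp [mul_assoc]⟩

instance TameLevel.finite_quotient (Kt : TameLevel n ℓ) (g : GL (Fin n) (AwayAdele ℓ)) :
    Finite (Kt.toSubgroup ⧸ Kt.conjInf g) := by
  have : CompactSpace Kt.toSubgroup := isCompact_iff_compactSpace.mp Kt.isCompact'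
  refine Subgroup.quotient_finite_of_isOpen _ ?_
  have h : (Kt.conjInf g : Set Kt.toSubgroup) =
      (fun k : Kt.toSubgroup => g * k * g⁻¹) ⁻¹' (Kt.toSubgroup : Set _) := by
    ext k
    exact Kt.mem_conjInf g k
  rw [h]
  exact Kt.isOpen'.preimage (by fun_prop)

instance TameLevel.fintype_quotient (Kt : TameLevel n ℓ) (g : GL (Fin n) (AwayAdele ℓ)) :
    Fintype (Kt.toSubgroup ⧸ Kt.conjInf g) := Fintype.ofFinite _

/-- The degree of `T(g)`: the index of `K ∩ g⁻¹ K g` in `K`. -/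
def TameLevel.heckeDegree (Kt : TameLevel n ℓ) (g : GL (Fin n) (AwayAdele ℓ)) : ℕ :=
  Nat.card (Kt.toSubgroup ⧸ Kt.conjInf g)

variable [Fact ℓ.Prime] (F : Type*) [Field F] (Kinf : Subgroup (GL (Fin n) ℝ))
  (Kt : TameLevel n ℓ) (Kl : OpenSubgroup (GL (Fin n) ℤ_[ℓ]))

variable {F Kinf Kt Kl} in
theorem heckeSummand_eq (g : GL (Fin n) (AwayAdele ℓ)) {m : ℕ} {f : PreCochain ℓ F Kinf m}
    (hf : f ∈ Cochain F Kinf (level Kt Kl) m) {k k' : Kt.toSubgroup}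
    (h : (k : Kt.toSubgroup ⧸ Kt.conjInf g) = k') (a : Fin (m + 1) → GL (Fin n) ℚ)
    (σ : Simplex Kinf m) (x : GLFin n ℓ) :
    f a σ (x * ((k : GL (Fin n) (AwayAdele ℓ)) * g⁻¹, 1)) =
      f a σ (x * ((k' : GL (Fin n) (AwayAdele ℓ)) * g⁻¹, 1)) := by
  have hk := (Kt.mem_conjInf g _).mp (QuotientGroup.eq.mp h)
  rw [← hf.2 a σ _ ((g * ((k⁻¹ * k' : Kt.toSubgroup) : GL (Fin n) (AwayAdele ℓ)) * g⁻¹, 1))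
    (Subgroup.mem_prod.mpr ⟨hk, one_mem _⟩)]
  congr 1
  rw [mul_assoc]
  congr 1
  ext1 <;> simp [mul_assoc]

variable (ℓ) in
/-- Cochain formula for the Hecke operator `T(g)`, `g ∈ GL_n(𝔸^{ℓ,∞})`, at level `K = K^ℓ K_ℓ`: the
composition of the pull-back to level `g K g⁻¹ ∩ K`, the pull-back along the map
`Y(K ∩ g⁻¹ K g) → Y(g K g⁻¹ ∩ K)` that is right multiplication by `g⁻¹`, and the corestriction from
level `K ∩ g⁻¹ K g` to level `K`, which is the sum over `K / (K ∩ g⁻¹ K g)`. As `g` has trivial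
component at `ℓ`, this coset space is the one for `K^ℓ`. On cochains of level `K` the summands do
not depend on the representatives of the cosets (`heckeSummand_eq`). -/
def preHecke (g : GL (Fin n) (AwayAdele ℓ)) (m : ℕ) :
    PreCochain ℓ F Kinf m →ₗ[F] PreCochain ℓ F Kinf m where
  toFun f a σ x := ∑ κ : Kt.toSubgroup ⧸ Kt.conjInf g,
      f a σ (x * ((κ.out : GL (Fin n) (AwayAdele ℓ)) * g⁻¹, 1))
  map_add' f f' := by
    funext a σ x
    simp [Finset.sum_add_distrib]
  map_smul' r f := by
    funext a σ x
    simp [Finset.mul_sum]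

variable {F Kinf Kt Kl} in
theorem preHecke_mem (g : GL (Fin n) (AwayAdele ℓ)) {m : ℕ} {f : PreCochain ℓ F Kinf m}
    (hf : f ∈ Cochain F Kinf (level Kt Kl) m) :
    preHecke ℓ F Kinf Kt g m f ∈ Cochain F Kinf (level Kt Kl) m := by
  refine ⟨fun γ a σ x => Finset.sum_congr rfl fun κ _ => ?_, fun a σ x u hu => ?_⟩
  · rw [mul_assoc]
    exact hf.1 γ a σ _
  · obtain ⟨hu1, hu2⟩ := Subgroup.mem_prod.mp hu
    let act : MulAction Kt.toSubgroup (Kt.toSubgroup ⧸ Kt.conjInf g) :=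
      MulAction.quotient Kt.toSubgroup (Kt.conjInf g)
    refine Fintype.sum_equiv
      (MulAction.toPerm (⟨u.1, hu1⟩ : Kt.toSubgroup)) _ _ fun κ => ?_
    have h1 : x * u * ((κ.out : GL (Fin n) (AwayAdele ℓ)) * g⁻¹, 1) =
        x * (((⟨u.1, hu1⟩ * κ.out : Kt.toSubgroup) : GL (Fin n) (AwayAdele ℓ)) * g⁻¹, 1) *
          (1, u.2) := by
      ext1 <;> simp [mul_assoc]
    rw [h1, hf.2 a σ _ (1, u.2) (Subgroup.mem_prod.mpr ⟨one_mem _, hu2⟩)]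
    refine heckeSummand_eq g hf ?_ a σ x
    rw [MulAction.toPerm_apply, QuotientGroup.out_eq']
    conv_rhs => rw [← QuotientGroup.out_eq' κ]
    rfl

/-- The Hecke operator `T(g)` on `H^m(Y(K), F)`. -/
def hecke (g : GL (Fin n) (AwayAdele ℓ)) (m : ℕ) :
    Coh F Kinf (level Kt Kl) m →ₗ[F] Coh F Kinf (level Kt Kl) m :=
  cohMap (preHecke ℓ F Kinf Kt g) (fun m f => by
    funext a σ x
    change ∑ i : Fin (m + 2), (-1 : F) ^ (i : ℕ) * ∑ κ : Kt.toSubgroup ⧸ Kt.conjInf g, _ =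
      ∑ κ : Kt.toSubgroup ⧸ Kt.conjInf g, ∑ i : Fin (m + 2), (-1 : F) ^ (i : ℕ) * _
    simp only [Finset.mul_sum]
    exact Finset.sum_comm) (fun _ _ hf => preHecke_mem g hf) m

/-- The finite idele in `𝔸^{ℓ,∞}` that is `q` at the place `q` and `1` at the other places. -/
def uniformizerAt (q : AwayPrime ℓ) : (AwayAdele ℓ)ˣ where
  val := RestrictedProduct.mulSingle (fun q : AwayPrime ℓ => PadicInt.subring (q : ℕ)) q
    ((q : ℕ) : ℚ_[(q : ℕ)])
  inv := RestrictedProduct.mulSingle (fun q : AwayPrime ℓ => PadicInt.subring (q : ℕ)) q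
    ((q : ℕ) : ℚ_[(q : ℕ)])⁻¹
  val_inv := by
    rw [← RestrictedProduct.mulSingle_mul, mul_inv_cancel₀, RestrictedProduct.mulSingle_one]
    exact_mod_cast q.2.1.ne_zero
  inv_val := by
    rw [← RestrictedProduct.mulSingle_mul, inv_mul_cancel₀, RestrictedProduct.mulSingle_one]
    exact_mod_cast q.2.1.ne_zero

/-- The diagonal matrix at the place `q` with `k` entries equal to `q` and `n - k` entries equal
to `1`. -/
def heckeMatrix (n : ℕ) (q : AwayPrime ℓ) (k : ℕ) : GL (Fin n) (AwayAdele ℓ) :=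
  Units.map (Matrix.diagonalRingHom (Fin n) (AwayAdele ℓ)).toMonoidHom
    (MulEquiv.piUnits.symm fun i => if (i : ℕ) < k then uniformizerAt q else 1)

/-- The prime `q ≠ ℓ` is prime to the level: `K^ℓ` contains the group `GL_n(ℤ_q)`, embedded at the
place `q`. -/
def TameLevel.IsUnramified (q : AwayPrime ℓ) : Prop :=
  ∀ h : GL (Fin n) (AwayAdele ℓ),
    (∀ q' : AwayPrime ℓ, q' ≠ q →
      Matrix.GeneralLinearGroup.map (RestrictedProduct.evalRingHom _ q') h = 1) →
    Matrix.GeneralLinearGroup.map (RestrictedProduct.evalRingHom _ q) h ∈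
      (integralPoints n (q : ℕ)).range →
    h ∈ Kt.toSubgroup

/-- Indices of the Hecke operators `T_{q,k}`: pairs of a prime `q ≠ ℓ` that is prime to the level
and an integer `1 ≤ k ≤ n`, represented by `k - 1 : Fin n`. -/
abbrev HeckeIndex : Type := {q : AwayPrime ℓ // Kt.IsUnramified q} × Fin n

/-- The matrix that defines `T_{q,k}`. -/
def HeckeIndex.matrix {Kt : TameLevel n ℓ} (s : HeckeIndex Kt) : GL (Fin n) (AwayAdele ℓ) :=
  heckeMatrix n s.1.1 (s.2 + 1)

/-- The commutative Hecke algebra `𝐓`: the `F`-algebra of polynomials in the `T_{q,k}`. Its maximal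
ideals include those of each of its quotients, such as its image in the endomorphisms of
`H^*(Y(K), F)`. -/
abbrev HeckeAlgebra : Type _ := MvPolynomial (HeckeIndex Kt) F

variable {Kt} in
/-- The action on `H^i(Y(K), F)` of a noncommutative polynomial in the `T_{q,k}`. As these operators
commute with each other, the result only depends on the class `toHeckeAlgebra s` of `s` in `𝐓`; this
is the action of `𝐓`. -/
def heckeAction (i : ℕ) :
    FreeAlgebra F (HeckeIndex Kt) →ₐ[F] Module.End F (Coh F Kinf (level Kt Kl) i) :=
  FreeAlgebra.lift F fun s => hecke F Kinf Kt Kl s.matrix i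

variable {Kt} in
/-- The canonical surjection onto `𝐓`. -/
def toHeckeAlgebra : FreeAlgebra F (HeckeIndex Kt) →ₐ[F] HeckeAlgebra F Kt :=
  FreeAlgebra.lift F MvPolynomial.X

/-! ### Localisation and Eisenstein classes -/

variable {F Kt}

/-- The class `c` vanishes in the localisation `H^i(Y(K), F)_𝔪`: it is annihilated by an element
of `𝐓` outside `𝔪`. -/
def VanishesAt (𝔪 : Ideal (HeckeAlgebra F Kt)) {i : ℕ} (c : Coh F Kinf (level Kt Kl) i) : Prop :=
  ∃ s : FreeAlgebra F (HeckeIndex Kt), toHeckeAlgebra F s ∉ 𝔪 ∧ heckeAction F Kinf Kl i s c = 0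

/-- The class `c` is a Hecke eigenclass belonging to `𝔪`: it is annihilated by `𝔪`. -/
def IsEigenclass (𝔪 : Ideal (HeckeAlgebra F Kt)) {i : ℕ} (c : Coh F Kinf (level Kt Kl) i) : Prop :=
  ∀ s : FreeAlgebra F (HeckeIndex Kt), toHeckeAlgebra F s ∈ 𝔪 → heckeAction F Kinf Kl i s c = 0

/-- The determinant `GL_n(𝔸^∞) → 𝔸^{∞,×}`. -/
def adelicDet (n ℓ : ℕ) [Fact ℓ.Prime] : GLFin n ℓ →* (AwayAdele ℓ)ˣ × ℚ_[ℓ]ˣ :=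
  Matrix.GeneralLinearGroup.det.prodMap Matrix.GeneralLinearGroup.det

/-- The diagonal embedding `ℚ^× → 𝔸^{∞,×}`. -/
def rationalIdele (ℓ : ℕ) [Fact ℓ.Prime] : ℚˣ →* (AwayAdele ℓ)ˣ × ℚ_[ℓ]ˣ :=
  (Units.map (ratToAway ℓ).toMonoidHom).prod (Units.map (algebraMap ℚ ℚ_[ℓ]).toMonoidHom)

/-- The group `A = ℚ^× \ 𝔸^× / ℝ_{>0} det(K) = ℚ_{>0} \ 𝔸^{∞,×} / det(K)` of connected components of
`Y(K)`. -/
abbrev ComponentGroup (Kt : TameLevel n ℓ) (Kl : OpenSubgroup (GL (Fin n) ℤ_[ℓ])) : Type :=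
  ((AwayAdele ℓ)ˣ × ℚ_[ℓ]ˣ) ⧸
    ((Units.posSubgroup ℚ).map (rationalIdele ℓ) ⊔ (level Kt Kl).map (adelicDet n ℓ))

/-- The image `⟨T⟩` of `det(g)` in `A`, for `T = T_{q,k} = T(g)`. -/
def componentClass (s : HeckeIndex Kt) : ComponentGroup Kt Kl :=
  QuotientGroup.mk (adelicDet n ℓ (s.matrix, 1))

/-- A maximal ideal `𝔪` of `𝐓` is Eisenstein if it contains `T - deg(T)` for all Hecke operators `T`,
that is, products `∏ T_{q,k}^{w(q,k)}`, with `⟨T⟩ = 1` in `A`. -/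
def IsEisensteinIdeal (𝔪 : Ideal (HeckeAlgebra F Kt)) : Prop :=
  ∀ w : HeckeIndex Kt →₀ ℕ, (w.prod fun s e => componentClass Kl s ^ e) = 1 →
    MvPolynomial.monomial w (1 : F) -
      MvPolynomial.C (((w.prod fun s e => Kt.heckeDegree s.matrix ^ e) : ℕ) : F) ∈ 𝔪

/-- A class `c` is Eisenstein if `T c = deg(T) ⟨T⟩ c` for all Hecke operators `T`, where `⟨T⟩ c` only
depends on the image of `T` in `A`: the family `v a = ⟨a⟩ c`, `a ∈ A`, satisfies
`T (⟨a⟩ c) = deg(T) ⟨a ⟨T⟩⟩ c`. -/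
def IsEisensteinClass {i : ℕ} (c : Coh F Kinf (level Kt Kl) i) : Prop :=
  ∃ v : ComponentGroup Kt Kl → Coh F Kinf (level Kt Kl) i, v 1 = c ∧
    ∀ (s : HeckeIndex Kt) (a : ComponentGroup Kt Kl),
      hecke F Kinf Kt Kl s.matrix i (v a) =
        (Kt.heckeDegree s.matrix : F) • v (a * componentClass Kl s)

end Hecke

end ArithCohomology

end

noncomputable section

namespace ArithCohomology

/-! ### Alternating sums of faces -/

/-! Suppose first that `𝔪` is not Eisenstein. A class that dies in the direct limit already dies at
some level `L = K^ℓ L_ℓ`, and `L_ℓ` may be shrunk to an open normal subgroup of `GL_n(ℤ_ℓ)`. Put `Γ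
= K_ℓ / L_ℓ`, a finite group. By the Hochschild–Serre spectral sequence, the kernel of pull-back in
degree `d` is filtered by subquotients of `H^a(Γ, H^b(Y(L), F))` with `b < d`, and these vanish at
`𝔪`.

The spectral sequence is replaced by a diagram chase in the double complex of equivariant functions
from `Γ^(j+1)` to the `m`-cochains of level `L`. Two facts carry it. The `Γ`-direction is exact in
positive degrees, because `K` acts freely on `GL_n(𝔸^∞)` (`exists_groupDiff_eq`). A family that is
pointwise a coboundary has an equivariant primitive (`exists_preDiff_eq`). The chase
(`exists_isInvariantCoboundary`, `invariantVanishing`) lowers `m` and raises `j`, multiplying at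
each stage by a Hecke element outside `𝔪`. Such an element exists because `Γ` is finite, and it
respects the double complex because the operators act away from `ℓ`. As `𝔪` is prime, the product of
these elements is still outside `𝔪`.

An eigenclass that vanishes at a maximal ideal is zero, so the second claim holds for such `𝔪`. If
`𝔪` is Eisenstein, every eigenclass is Eisenstein by algebra alone: put `⟨a⟩c = deg(T)⁻¹ T c` for
any monomial `T` with `⟨T⟩ = a` and `deg T ≠ 0` in `F`, and `0` if there is none
(`exists_twist_family`). Consistency needs inverses of the classes `⟨T⟩` among monomials, hence that
these classes have finite order, which follows from compactness of the integral unit ideles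
(`isOfFinOrder_componentClass`).

Commutativity of the operators on cohomology is never invoked: everything is done with lifts to the
free algebra. -/

/-- A double alternating sum of terms that satisfy the simplicial identities vanishes. -/
theorem sum_alternating_faces_eq_zero (R : Type*) {E : Type*} [CommRing R] [AddCommGroup E]
    [Module R E] {m : ℕ} (φ : Fin (m + 3) → Fin (m + 2) → E)
    (h : ∀ i j : Fin (m + 2), i ≤ j → φ j.succ i = φ i.castSucc j) :
    ∑ i : Fin (m + 3), (-1 : R) ^ (i : ℕ) •
      ∑ j : Fin (m + 2), (-1 : R) ^ (j : ℕ) • φ i j = 0 := by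
  simp only [Finset.smul_sum, smul_smul]
  rw [Finset.sum_comm]
  simp only [← Finset.sum_product']
  let P := Fin (m + 2) × Fin (m + 3)
  let S : Finset P := {ij : P | (ij.2 : ℕ) ≤ (ij.1 : ℕ)}
  rw [Finset.univ_product_univ, ← Finset.sum_add_sum_compl S, ← eq_neg_iff_add_eq_zero,
    ← Finset.sum_neg_distrib]
  -- A pair lists the inner index first and the outer index second. The term `(i, j)` with `j ≤ i`
  -- cancels against `(j, i + 1)`: the faces agree and the sign exponent grows by one.
  let ψ : ∀ ij : P, ij ∈ S → P := fun ij hij =>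
    (Fin.castLT ij.2 (lt_of_le_of_lt (Finset.mem_filter.mp hij).right (Fin.is_lt ij.1)), ij.1.succ)
  apply Finset.sum_bij ψ
  · intro ij hij
    simp_rw [S, ψ, Finset.compl_filter, Finset.mem_filter_univ, Fin.val_succ,
      Fin.val_castLT] at hij ⊢
    lia
  · rintro ⟨i, j⟩ hij ⟨i', j'⟩ hij' h
    rw [Prod.mk_inj]
    exact ⟨by simpa [ψ] using! congr_arg Prod.snd h,
      by simpa [ψ, Fin.castSucc_castLT] using! congr_arg Fin.castSucc (congr_arg Prod.fst h)⟩
  · rintro ⟨i', j'⟩ hij'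
    simp_rw [S, Finset.compl_filter, Finset.mem_filter_univ, not_le] at hij'
    refine ⟨(j'.pred <| ?_, Fin.castSucc i'), ?_, ?_⟩
    · rintro rfl
      simp only [Fin.val_zero, not_lt_zero] at hij'
    · simpa [S] using! Nat.le_sub_one_of_lt hij'
    · simp only [ψ, Fin.castLT_castSucc, Fin.succ_pred]
  · rintro ⟨i, j⟩ hij
    have hij' : (j : ℕ) ≤ (i : ℕ) := by simpa [S] using! hij
    have key := h (Fin.castLT j (lt_of_le_of_lt hij' i.is_lt)) i (by
      rw [Fin.le_iff_val_le_val]; exact hij')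
    rw [Fin.castSucc_castLT] at key
    simp only [ψ, Fin.val_succ, Fin.val_castLT]
    rw [key, ← neg_smul]
    congr 1
    ring

theorem succAbove_comp_succAbove {m : ℕ} {i j : Fin (m + 2)} (h : i ≤ j) :
    j.succ.succAbove ∘ i.succAbove = i.castSucc.succAbove ∘ j.succAbove := by
  funext k
  dsimp [Fin.succAbove]
  rcases i with ⟨i, _⟩
  rcases j with ⟨j, _⟩
  rcases k with ⟨k, _⟩
  split_ifs <;> · simp at * <;> lia

/-! ### Cochains, levels and the component at `ℓ` -/

section Cochains

variable {n ℓ : ℕ} [Fact ℓ.Prime] {F : Type*} [Field F] {Kinf : Subgroup (GL (Fin n) ℝ)}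

theorem face_face {m : ℕ} (i : Fin (m + 3)) (j : Fin (m + 2)) (σ : Simplex Kinf (m + 2)) :
    face j (face i σ) = σ.comp ⟨stdSimplex.map (i.succAbove ∘ j.succAbove),
      stdSimplex.continuous_map _⟩ := by
  ext x
  exact congrArg σ (stdSimplex.map_comp_apply _ _ _)

theorem preDiff_preDiff {m : ℕ} (f : PreCochain ℓ F Kinf m) :
    preDiff F Kinf (m + 1) (preDiff F Kinf m f) = 0 := by
  funext a σ x
  refine sum_alternating_faces_eq_zero F
    (fun i j => f ((a ∘ i.succAbove) ∘ j.succAbove) (face j (face i σ)) x) fun i j hij => ?_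
  simp only [face_face, Function.comp_assoc, succAbove_comp_succAbove hij]

/-- The element of `GL_n(𝔸^∞)` with component `k` at `ℓ` and trivial components elsewhere. -/
def placeAt (n ℓ : ℕ) [Fact ℓ.Prime] : GL (Fin n) ℤ_[ℓ] →* GLFin n ℓ :=
  (MonoidHom.inr _ _).comp (integralPoints n ℓ)

theorem integralPoints_injective : Function.Injective (integralPoints n ℓ) :=
  Units.map_injective (Matrix.map_injective (FaithfulSMul.algebraMap_injective ℤ_[ℓ] ℚ_[ℓ]))

theorem placeAt_mem {Kt : TameLevel n ℓ} {Kl : OpenSubgroup (GL (Fin n) ℤ_[ℓ])}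
    {k : GL (Fin n) ℤ_[ℓ]} (hk : k ∈ Kl) : placeAt n ℓ k ∈ level Kt Kl :=
  Subgroup.mem_prod.mpr ⟨one_mem _, Subgroup.mem_map_of_mem _ hk⟩

theorem inl_mem {Kt : TameLevel n ℓ} {Kl : OpenSubgroup (GL (Fin n) ℤ_[ℓ])}
    {t : GL (Fin n) (AwayAdele ℓ)} (ht : t ∈ Kt.toSubgroup) :
    ((t, 1) : GLFin n ℓ) ∈ level Kt Kl :=
  Subgroup.mem_prod.mpr ⟨ht, one_mem _⟩

theorem exists_of_mem_level {Kt : TameLevel n ℓ} {Kl : OpenSubgroup (GL (Fin n) ℤ_[ℓ])}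
    {u : GLFin n ℓ} (hu : u ∈ level Kt Kl) :
    ∃ t ∈ Kt.toSubgroup, ∃ k ∈ Kl, u = (t, 1) * placeAt n ℓ k := by
  obtain ⟨h1, k, hk, h2⟩ := Subgroup.mem_prod.mp hu
  exact ⟨u.1, h1, k, hk, Prod.ext (by simp [placeAt]) (by simp [placeAt, h2])⟩

/-! ### The Hecke action on cochains -/

variable {Kt : TameLevel n ℓ}

variable (F Kinf Kt) in
/-- The action of noncommutative polynomials in the `T_{q,k}` on functions. -/
def preAction (m : ℕ) :
    FreeAlgebra F (HeckeIndex Kt) →ₐ[F] Module.End F (PreCochain ℓ F Kinf m) :=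
  FreeAlgebra.lift F fun s => preHecke ℓ F Kinf Kt s.matrix m

theorem preHecke_preDiff (g : GL (Fin n) (AwayAdele ℓ)) {m : ℕ} (f : PreCochain ℓ F Kinf m) :
    preDiff F Kinf m (preHecke ℓ F Kinf Kt g m f) =
      preHecke ℓ F Kinf Kt g (m + 1) (preDiff F Kinf m f) := by
  funext a σ x
  change ∑ i : Fin (m + 2), (-1 : F) ^ (i : ℕ) * ∑ κ : Kt.toSubgroup ⧸ Kt.conjInf g, _ =
    ∑ κ : Kt.toSubgroup ⧸ Kt.conjInf g, ∑ i : Fin (m + 2), (-1 : F) ^ (i : ℕ) * _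
  simp only [Finset.mul_sum]
  exact Finset.sum_comm

theorem preAction_preDiff {m : ℕ} (r : FreeAlgebra F (HeckeIndex Kt)) :
    ∀ f : PreCochain ℓ F Kinf m, preDiff F Kinf m (preAction F Kinf Kt m r f) =
      preAction F Kinf Kt (m + 1) r (preDiff F Kinf m f) := by
  induction r using FreeAlgebra.induction with
  | grade0 t => intro f; simp
  | grade1 s => intro f; simpa [preAction] using preHecke_preDiff _ f
  | mul r s hr hs => intro f; simp [hr, hs]
  | add r s hr hs => intro f; simp [hr, hs]

theorem preAction_mem {Ll : OpenSubgroup (GL (Fin n) ℤ_[ℓ])} {m : ℕ}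
    (r : FreeAlgebra F (HeckeIndex Kt)) :
    ∀ f ∈ Cochain F Kinf (level Kt Ll) m,
      preAction F Kinf Kt m r f ∈ Cochain F Kinf (level Kt Ll) m := by
  induction r using FreeAlgebra.induction with
  | grade0 t =>
    intro f hf
    rw [AlgHom.commutes, Module.algebraMap_end_apply]
    exact Submodule.smul_mem _ t hf
  | grade1 s =>
    intro f hf
    rw [preAction, FreeAlgebra.lift_ι_apply]
    exact preHecke_mem _ hf
  | mul r s hr hs =>
    intro f hf
    rw [map_mul]
    exact hr _ (hs _ hf)
  | add r s hr hs =>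
    intro f hf
    rw [map_add]
    exact Submodule.add_mem _ (hr _ hf) (hs _ hf)

/-- The Hecke action commutes with right translations at the place `ℓ`. -/
theorem preAction_translate {m : ℕ} (k : GL (Fin n) ℤ_[ℓ]) (r : FreeAlgebra F (HeckeIndex Kt)) :
    ∀ f : PreCochain ℓ F Kinf m,
      preAction F Kinf Kt m r (fun a σ x => f a σ (x * placeAt n ℓ k)) =
        fun a σ x => preAction F Kinf Kt m r f a σ (x * placeAt n ℓ k) := by
  induction r using FreeAlgebra.induction with
  | grade0 t => intro f; simp; rfl
  | grade1 s =>
    intro f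
    funext a σ x
    simp only [preAction, FreeAlgebra.lift_ι_apply]
    refine Finset.sum_congr rfl fun κ _ => ?_
    exact congrArg (f a σ) (Prod.ext (by simp [placeAt]) (by simp [placeAt]))
  | mul r s hr hs => intro f; simp [hr, hs]
  | add r s hr hs =>
    intro f
    funext a σ x
    simp [hr, hs]

theorem preAction_mem_cocycle {Ll : OpenSubgroup (GL (Fin n) ℤ_[ℓ])} {m : ℕ}
    (r : FreeAlgebra F (HeckeIndex Kt)) {f : PreCochain ℓ F Kinf m}
    (hf : f ∈ Cocycle F Kinf (level Kt Ll) m) :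
    preAction F Kinf Kt m r f ∈ Cocycle F Kinf (level Kt Ll) m := by
  refine ⟨preAction_mem r f hf.1, ?_⟩
  have h0 : preDiff F Kinf m f = 0 := hf.2
  exact (preAction_preDiff r f).trans (by rw [h0, map_zero])

/-- The formula on representatives does not involve `Ll`, so one and the same noncommutative
polynomial can be followed through levels `K` and `L` at once. -/
theorem heckeAction_mk {Ll : OpenSubgroup (GL (Fin n) ℤ_[ℓ])} {m : ℕ}
    (r : FreeAlgebra F (HeckeIndex Kt)) :
    ∀ z : Cocycle F Kinf (level Kt Ll) m,
      heckeAction F Kinf Ll m r (Submodule.Quotient.mk z) =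
        Submodule.Quotient.mk ⟨preAction F Kinf Kt m r z, preAction_mem_cocycle r z.2⟩ := by
  induction r using FreeAlgebra.induction with
  | grade0 t =>
    intro z
    simp only [AlgHom.commutes, Module.algebraMap_end_apply]
    rfl
  | grade1 s =>
    intro z
    simp only [heckeAction, preAction, FreeAlgebra.lift_ι_apply]
    rfl
  | mul r s hr hs =>
    intro z
    simp only [map_mul, Module.End.mul_apply, hr, hs]
  | add r s hr hs =>
    intro z
    simp only [map_add, LinearMap.add_apply, hr, hs]
    rfl

theorem heckeAction_mk_eq_zero {Ll : OpenSubgroup (GL (Fin n) ℤ_[ℓ])} {m : ℕ}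
    (r : FreeAlgebra F (HeckeIndex Kt)) (z : Cocycle F Kinf (level Kt Ll) m) :
    heckeAction F Kinf Ll m r (Submodule.Quotient.mk z) = 0 ↔
      preAction F Kinf Kt m r z ∈ Coboundary F Kinf (level Kt Ll) m := by
  rw [heckeAction_mk, Submodule.Quotient.mk_eq_zero]
  rfl

end Cochains


/-! ### Homogeneous cochains of a group -/

section GroupDiff

variable {Γ : Type*} {F : Type*} [Field F] {E E' : Type*} [AddCommGroup E] [Module F E]
  [AddCommGroup E'] [Module F E']

variable (F) in
/-- The differential of homogeneous cochains. -/
def groupDiff {j : ℕ} (f : (Fin (j + 1) → Γ) → E) (γ : Fin (j + 2) → Γ) : E :=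
  ∑ i : Fin (j + 2), (-1 : F) ^ (i : ℕ) • f (γ ∘ i.succAbove)

theorem groupDiff_groupDiff {j : ℕ} (f : (Fin (j + 1) → Γ) → E) :
    groupDiff F (groupDiff F f) = 0 := by
  funext γ
  refine sum_alternating_faces_eq_zero F (fun i j => f ((γ ∘ i.succAbove) ∘ j.succAbove))
    fun i j hij => ?_
  simp only [Function.comp_assoc, succAbove_comp_succAbove hij]

theorem map_groupDiff (φ : E →ₗ[F] E') {j : ℕ} (f : (Fin (j + 1) → Γ) → E) (γ : Fin (j + 2) → Γ) :
    φ (groupDiff F f γ) = groupDiff F (fun γ => φ (f γ)) γ := by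
  simp [groupDiff, map_sum]

theorem groupDiff_sub {j : ℕ} (f g : (Fin (j + 1) → Γ) → E) :
    groupDiff F (f - g) = groupDiff F f - groupDiff F g := by
  funext γ
  simp [groupDiff, smul_sub, Finset.sum_sub_distrib]

/-- The cone identity: prepending a fixed vertex is a contracting homotopy. It is not equivariant in
general; `exists_groupDiff_eq` repairs this by letting the vertex vary with the point. -/
theorem groupDiff_cons {j : ℕ} (f : (Fin (j + 2) → Γ) → E) (c : Γ) (γ : Fin (j + 2) → Γ) :
    groupDiff F f (Fin.cons c γ : Fin (j + 3) → Γ) =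
      f γ - groupDiff F (fun γ' : Fin (j + 1) → Γ => f (Fin.cons c γ' : Fin (j + 2) → Γ)) γ := by
  rw [groupDiff, Fin.sum_univ_succ, sub_eq_add_neg, groupDiff, ← Finset.sum_neg_distrib]
  congr 1
  · simp only [Fin.val_zero, pow_zero, one_smul]
    rfl
  · refine Finset.sum_congr rfl fun i _ => ?_
    rw [Fin.cons_comp_succ_succAbove, Fin.val_succ, pow_succ, mul_neg, mul_one, neg_smul]
    rfl

/-- The differential at an edge is the difference of the values at its ends. Combined with
equivariance, this identifies closed families with `j = 0` with cochains of level `K`. -/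
theorem apply_eq_of_groupDiff_eq_zero {f : (Fin 1 → Γ) → E} (hf : groupDiff F f = 0)
    (γ γ' : Fin 1 → Γ) : f γ = f γ' := by
  have h := congrFun hf (Fin.cons (γ' 0) γ)
  have e0 : ((Fin.cons (γ' 0) γ : Fin 2 → Γ) ∘ Fin.succAbove (0 : Fin 2)) = γ := rfl
  have e1 : ((Fin.cons (γ' 0) γ : Fin 2 → Γ) ∘ Fin.succAbove (1 : Fin 2)) = γ' := by
    funext i
    rw [Subsingleton.elim i 0]
    rfl
  change ∑ i : Fin 2, (-1 : F) ^ (i : ℕ) • f ((Fin.cons (γ' 0) γ : Fin 2 → Γ) ∘ i.succAbove) = 0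
    at h
  rw [Fin.sum_univ_two, e0, e1] at h
  simpa [← sub_eq_add_neg, sub_eq_zero] using h

end GroupDiff

instance compactSpace_generalLinearGroup {n ℓ : ℕ} [Fact ℓ.Prime] :
    CompactSpace (GL (Fin n) ℤ_[ℓ]) := by
  have : CompactSpace (Matrix (Fin n) (Fin n) ℤ_[ℓ]) :=
    inferInstanceAs (CompactSpace (Fin n → Fin n → ℤ_[ℓ]))
  have : T1Space (Matrix (Fin n) (Fin n) ℤ_[ℓ]) :=
    inferInstanceAs (T1Space (Fin n → Fin n → ℤ_[ℓ]))
  exact inferInstanceAs (CompactSpace (Matrix (Fin n) (Fin n) ℤ_[ℓ])ˣ)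

/-! ### The Hochschild–Serre argument for `K_ℓ / L_ℓ` -/

section HochschildSerre

variable {n ℓ : ℕ} [Fact ℓ.Prime] {F : Type*} [Field F] {Kinf : Subgroup (GL (Fin n) ℝ)}
  {Kt : TameLevel n ℓ} {Kl Ll : OpenSubgroup (GL (Fin n) ℤ_[ℓ])}
  {Γ : Type*} [Group Γ] {π : Kl.toSubgroup →* Γ}

omit [Group Γ] in
theorem groupDiff_apply {j m : ℕ} (f : (Fin (j + 1) → Γ) → PreCochain ℓ F Kinf m)
    (γ : Fin (j + 2) → Γ) (a : Fin (m + 1) → GL (Fin n) ℚ) (σ : Simplex Kinf m)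
    (x : GLFin n ℓ) : groupDiff F f γ a σ x = groupDiff F (fun γ => f γ a σ x) γ := by
  simp [groupDiff, Finset.sum_apply]

variable (F Kinf Kt Ll π) in
/-- Homogeneous cochains of a quotient `Γ` of `K_ℓ`, with values in the cochains of
level `K^ℓ L_ℓ`. -/
def EquivariantCochain (j m : ℕ) : Submodule F ((Fin (j + 1) → Γ) → PreCochain ℓ F Kinf m) where
  carrier := {f | (∀ γ, f γ ∈ Cochain F Kinf (level Kt Ll) m) ∧ ∀ (k : Kl.toSubgroup) γ a σ x,
    f (fun i => π k * γ i) a σ x = f γ a σ (x * placeAt n ℓ k)}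
  zero_mem' := ⟨fun _ => Submodule.zero_mem _, fun _ _ _ _ _ => rfl⟩
  add_mem' := by
    rintro f g ⟨hf, hf'⟩ ⟨hg, hg'⟩
    exact ⟨fun γ => Submodule.add_mem _ (hf γ) (hg γ),
      fun k γ a σ x => by simp [hf' k γ a σ x, hg' k γ a σ x]⟩
  smul_mem' := by
    rintro r f ⟨hf, hf'⟩
    exact ⟨fun γ => Submodule.smul_mem _ r (hf γ), fun k γ a σ x => by simp [hf' k γ a σ x]⟩

theorem groupDiff_mem {j m : ℕ} {f : (Fin (j + 1) → Γ) → PreCochain ℓ F Kinf m}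
    (hf : f ∈ EquivariantCochain F Kinf Kt Ll π j m) :
    groupDiff F f ∈ EquivariantCochain F Kinf Kt Ll π (j + 1) m := by
  refine ⟨fun γ => Submodule.sum_mem _ fun i _ => Submodule.smul_mem _ _ (hf.1 _),
    fun k γ a σ x => ?_⟩
  rw [groupDiff_apply, groupDiff_apply]
  refine Finset.sum_congr rfl fun i _ => congrArg ((-1 : F) ^ (i : ℕ) • ·) ?_
  exact hf.2 k (γ ∘ i.succAbove) a σ x

theorem preDiff_mem_equivariantCochain {j m : ℕ}
    {f : (Fin (j + 1) → Γ) → PreCochain ℓ F Kinf m}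
    (hf : f ∈ EquivariantCochain F Kinf Kt Ll π j m) :
    (fun γ => preDiff F Kinf m (f γ)) ∈ EquivariantCochain F Kinf Kt Ll π j (m + 1) := by
  refine ⟨fun γ => preDiff_mem F Kinf (hf.1 γ), fun k γ a σ x => ?_⟩
  change ∑ i : Fin (m + 2), _ = ∑ i : Fin (m + 2), _
  refine Finset.sum_congr rfl fun i _ => congrArg ((-1 : F) ^ (i : ℕ) * ·) ?_
  exact hf.2 k γ _ _ x

theorem preAction_mem_equivariantCochain {j m : ℕ} (r : FreeAlgebra F (HeckeIndex Kt))
    {f : (Fin (j + 1) → Γ) → PreCochain ℓ F Kinf m}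
    (hf : f ∈ EquivariantCochain F Kinf Kt Ll π j m) :
    (fun γ => preAction F Kinf Kt m r (f γ)) ∈ EquivariantCochain F Kinf Kt Ll π j m := by
  refine ⟨fun γ => preAction_mem r _ (hf.1 γ), fun k γ a σ x => ?_⟩
  have h : f (fun i => π k * γ i) = fun a σ x => f γ a σ (x * placeAt n ℓ k) := by
    funext a σ x
    exact hf.2 k γ a σ x
  simp only [h, preAction_translate]

/-- Cochains of level `K^ℓ L_ℓ` are preserved by right translation by `GL_n(ℤ_ℓ)`, if `L_ℓ` is
normal. -/
theorem translate_mem_cochain (hL : Ll.toSubgroup.Normal) {m : ℕ} {f : PreCochain ℓ F Kinf m}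
    (hf : f ∈ Cochain F Kinf (level Kt Ll) m) (k : GL (Fin n) ℤ_[ℓ]) :
    (fun a σ x => f a σ (x * placeAt n ℓ k)) ∈ Cochain F Kinf (level Kt Ll) m := by
  refine ⟨fun γ a σ x => ?_, fun a σ x u hu => ?_⟩
  · change f _ _ _ = f _ _ _
    rw [mul_assoc]
    exact hf.1 γ a σ _
  · obtain ⟨t, ht, l, hl, rfl⟩ := exists_of_mem_level hu
    have h : x * ((t, 1) * placeAt n ℓ l) * placeAt n ℓ k =
        x * placeAt n ℓ k * ((t, 1) * placeAt n ℓ (k⁻¹ * l * k)) := by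
      ext1 <;> simp [placeAt, mul_assoc]
    change f a σ _ = f a σ _
    rw [h]
    refine hf.2 a σ _ _ (mul_mem (inl_mem ht) (placeAt_mem ?_))
    simpa using hL.conj_mem l hl k⁻¹

theorem eq_of_inl_mul_placeAt_eq {t t' : GL (Fin n) (AwayAdele ℓ)} {k k' : GL (Fin n) ℤ_[ℓ]}
    (h : ((t, 1) : GLFin n ℓ) * placeAt n ℓ k = (t', 1) * placeAt n ℓ k') : k = k' :=
  integralPoints_injective (by simpa [placeAt] using congrArg Prod.snd h)

variable (Kt π) in
/-- The group `K` acts freely on `GL_n(𝔸^∞)`, so that there is an equivariant map to `Γ`. -/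
theorem exists_equivariant_map :
    ∃ c : GLFin n ℓ → Γ, ∀ x, ∀ t ∈ Kt.toSubgroup, ∀ k : Kl.toSubgroup,
      c (x * ((t, 1) * placeAt n ℓ k)) = (π k)⁻¹ * c x := by
  let rep : GLFin n ℓ → GLFin n ℓ := fun x => (x : GLFin n ℓ ⧸ level Kt Kl).out
  have hrep : ∀ x, (rep x)⁻¹ * x ∈ level Kt Kl := fun x =>
    QuotientGroup.eq.mp (QuotientGroup.out_eq' _)
  choose τ hτ κ hκ hτκ using fun x => exists_of_mem_level (hrep x)
  -- Here `x = rep x * (τ x, κ x)`, and `κ x` is unique since `GL_n(ℤ_ℓ)` embeds in `GL_n(ℚ_ℓ)`.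
  -- Right translation by `k` turns `κ x` into `κ x * k`; the inverse makes this a left translation.
  refine ⟨fun x => (π ⟨κ x, hκ x⟩)⁻¹, fun x t ht k => ?_⟩
  have h1 : rep (x * ((t, 1) * placeAt n ℓ k)) = rep x := by
    refine congrArg (Quotient.out ·) (QuotientGroup.mk_mul_of_mem x ?_)
    exact mul_mem (inl_mem ht) (placeAt_mem k.2)
  have h2 := hτκ (x * ((t, 1) * placeAt n ℓ k))
  rw [h1, ← mul_assoc, hτκ x] at h2
  have h3 : ((τ x, 1) : GLFin n ℓ) * placeAt n ℓ (κ x) * ((t, 1) * placeAt n ℓ k) =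
      (τ x * t, 1) * placeAt n ℓ (κ x * k) := by
    ext1 <;> simp [placeAt]
  have h4 : (⟨κ (x * ((t, 1) * placeAt n ℓ k)), hκ _⟩ : Kl.toSubgroup) = ⟨κ x, hκ x⟩ * k :=
    Subtype.ext (eq_of_inl_mul_placeAt_eq (h3.symm.trans h2)).symm
  change (π _)⁻¹ = (π k)⁻¹ * (π _)⁻¹
  rw [h4, map_mul, mul_inv_rev]

/-- The primitive is the cone on `f` whose apex depends on the point: `c (a₀⁻¹ x)`, with `c` from
`exists_equivariant_map`. Equivariance of `c` under `K` makes the cone equivariant and of level `L`.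
Nothing relates `c` to `GL_n(ℚ)`, so the first vertex `a₀` of the `EG`-coordinate is used to make
the apex invariant under rational matrices. -/
theorem exists_groupDiff_eq (hle : Ll ≤ Kl)
    (hker : ∀ k : Kl.toSubgroup, π k = 1 ↔ (k : GL (Fin n) ℤ_[ℓ]) ∈ Ll) {j m : ℕ}
    {f : (Fin (j + 2) → Γ) → PreCochain ℓ F Kinf m}
    (hf : f ∈ EquivariantCochain F Kinf Kt Ll π (j + 1) m) (hf0 : groupDiff F f = 0) :
    ∃ g ∈ EquivariantCochain F Kinf Kt Ll π j m, groupDiff F g = f := by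
  obtain ⟨c, hc⟩ := exists_equivariant_map Kt π
  have hc1 : ∀ x, ∀ k : Kl.toSubgroup, c (x * placeAt n ℓ k) = (π k)⁻¹ * c x := fun x k => by
    rw [← hc x 1 (one_mem _) k, Prod.mk_one_one, one_mul]
  refine ⟨fun γ a σ x => f (Fin.cons (c (rationalPoints n ℓ (a 0)⁻¹ * x)) γ) a σ x,
    ⟨fun γ => ⟨fun q a σ x => ?_, fun a σ x u hu => ?_⟩, fun k γ a σ x => ?_⟩, ?_⟩
  · have h : rationalPoints n ℓ (q * a 0)⁻¹ * (rationalPoints n ℓ q * x) =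
        rationalPoints n ℓ (a 0)⁻¹ * x := by
      rw [← mul_assoc, ← map_mul, mul_inv_rev, inv_mul_cancel_right]
    simp only [h]
    exact (hf.1 _).1 q a σ x
  · have h : c (rationalPoints n ℓ (a 0)⁻¹ * (x * u)) = c (rationalPoints n ℓ (a 0)⁻¹ * x) := by
      obtain ⟨t, ht, l, hl, rfl⟩ := exists_of_mem_level hu
      rw [← mul_assoc, hc _ t ht ⟨l, hle hl⟩, (hker ⟨l, hle hl⟩).mpr hl, inv_one, one_mul]
    simp only [h]
    exact (hf.1 _).2 a σ x u hu
  · change f _ a σ x = f _ a σ _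
    rw [← mul_assoc, hc1, ← hf.2 k]
    congr 1
    funext i
    refine Fin.cases ?_ (fun i => ?_) i <;> simp
  · funext γ a σ x
    have h := groupDiff_apply f (Fin.cons (c (rationalPoints n ℓ (a 0)⁻¹ * x)) γ) a σ x
    rw [hf0, groupDiff_cons] at h
    rw [groupDiff_apply]
    exact (sub_eq_zero.mp h.symm).symm

/-- A family of coboundaries of level `K^ℓ L_ℓ` is the coboundary of an equivariant family. -/
theorem exists_preDiff_eq (hL : Ll.toSubgroup.Normal) (hπ : Function.Surjective π)
    (hker : ∀ k : Kl.toSubgroup, π k = 1 ↔ (k : GL (Fin n) ℤ_[ℓ]) ∈ Ll) {j m : ℕ}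
    {f : (Fin (j + 1) → Γ) → PreCochain ℓ F Kinf (m + 1)}
    (hf : f ∈ EquivariantCochain F Kinf Kt Ll π j (m + 1))
    (hfb : ∀ γ, f γ ∈ Coboundary F Kinf (level Kt Ll) (m + 1)) :
    ∃ b ∈ EquivariantCochain F Kinf Kt Ll π j m, ∀ γ, preDiff F Kinf m (b γ) = f γ := by
  choose b hb hbf using hfb
  let s := Function.surjInv hπ
  have hs : ∀ γ, π (s γ) = γ := Function.surjInv_eq hπ
  -- `Γ` acts freely on tuples, so arbitrary primitives are kept only where `γ 0 = 1` and are moved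
  -- to the rest of the orbit by translating by a lift `s (γ 0)`. Another lift differs by an element
  -- of `Ll`, which acts trivially.
  refine ⟨fun γ a σ x => b (fun i => (γ 0)⁻¹ * γ i) a σ (x * placeAt n ℓ (s (γ 0))),
    ⟨fun γ => translate_mem_cochain hL (hb _) _, fun k γ a σ x => ?_⟩, fun γ => ?_⟩
  · have h1 : (fun i => (π k * γ 0)⁻¹ * (π k * γ i)) = fun i => (γ 0)⁻¹ * γ i := by
      funext i
      group
    have h2 : ((k * s (γ 0))⁻¹ * s (π k * γ 0) : Kl.toSubgroup).1 ∈ Ll := by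
      rw [← hker]
      simp [hs]
    have h3 : x * placeAt n ℓ (s (π k * γ 0)) = x * placeAt n ℓ k * placeAt n ℓ (s (γ 0)) *
        placeAt n ℓ ((k * s (γ 0))⁻¹ * s (π k * γ 0) : Kl.toSubgroup).1 := by
      rw [mul_assoc, mul_assoc, ← map_mul, ← map_mul]
      congr 2
      push_cast
      group
    simp only [h1, h3]
    exact (hb _).2 a σ _ _ (placeAt_mem h2)
  · funext a σ x
    have h := hf.2 (s (γ 0)) (fun i => (γ 0)⁻¹ * γ i) a σ x
    simp only [hs, mul_inv_cancel_left] at h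
    rw [h, ← hbf]
    rfl

theorem preAction_mem_coboundary {m : ℕ} (r : FreeAlgebra F (HeckeIndex Kt))
    {f : PreCochain ℓ F Kinf m} (hf : f ∈ Coboundary F Kinf (level Kt Ll) m) :
    preAction F Kinf Kt m r f ∈ Coboundary F Kinf (level Kt Ll) m := by
  cases m with
  | zero =>
    have h0 : f = 0 := hf
    rw [h0, map_zero]
    exact Submodule.zero_mem _
  | succ m =>
    obtain ⟨b, hb, rfl⟩ := hf
    exact ⟨_, preAction_mem r b hb, preAction_preDiff r b⟩

/-- If the cohomology of level `K^ℓ L_ℓ` vanishes at `𝔪`, then finitely many classes are annihilated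
by a common element outside `𝔪`. -/
theorem exists_preAction_mem_coboundary {𝔪 : Ideal (HeckeAlgebra F Kt)} (h𝔪 : 𝔪.IsPrime) {m : ℕ}
    (hvan : ∀ x : Coh F Kinf (level Kt Ll) m, VanishesAt Kinf Ll 𝔪 x) {ι : Type*} [Finite ι]
    (z : ι → PreCochain ℓ F Kinf m) (hz : ∀ i, z i ∈ Cocycle F Kinf (level Kt Ll) m) :
    ∃ r : FreeAlgebra F (HeckeIndex Kt), toHeckeAlgebra F r ∉ 𝔪 ∧
      ∀ i, preAction F Kinf Kt m r (z i) ∈ Coboundary F Kinf (level Kt Ll) m := by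
  classical
  suffices h : ∀ s : Finset ι, ∃ r : FreeAlgebra F (HeckeIndex Kt), toHeckeAlgebra F r ∉ 𝔪 ∧
      ∀ i ∈ s, preAction F Kinf Kt m r (z i) ∈ Coboundary F Kinf (level Kt Ll) m by
    cases nonempty_fintype ι
    obtain ⟨r, hr, h⟩ := h Finset.univ
    exact ⟨r, hr, fun i => h i (Finset.mem_univ i)⟩
  intro s
  induction s using Finset.induction_on with
  | empty =>
    refine ⟨1, ?_, by simp⟩
    rw [map_one]
    exact fun h => h𝔪.ne_top ((Ideal.eq_top_iff_one _).mpr h)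
  | insert i s _ ih =>
    obtain ⟨r, hr, h⟩ := ih
    -- The hypothesis is applied to `r z_i`, not to `z_i`: then `r' * r` works for the new class by
    -- construction, and for the old ones because `r'` preserves coboundaries.
    obtain ⟨r', hr', h'⟩ := hvan (Submodule.Quotient.mk ⟨_, preAction_mem_cocycle r (hz i)⟩)
    rw [heckeAction_mk_eq_zero] at h'
    refine ⟨r' * r, ?_, fun i' hi' => ?_⟩
    · rw [map_mul]
      exact fun h => (h𝔪.mem_or_mem h).elim hr' hr
    · rw [map_mul]
      rcases Finset.mem_insert.mp hi' with rfl | hi'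
      · exact h'
      · exact preAction_mem_coboundary r' (h i' hi')

variable (Kt Ll π) in
/-- Coboundaries in the kernel of the differential of homogeneous cochains. -/
def IsInvariantCoboundary {j : ℕ} :
    {m : ℕ} → ((Fin (j + 1) → Γ) → PreCochain ℓ F Kinf m) → Prop
  | 0, f => f = 0
  | m + 1, f => ∃ b ∈ EquivariantCochain F Kinf Kt Ll π j m, groupDiff F b = 0 ∧
      ∀ γ, preDiff F Kinf m (b γ) = f γ

variable (F Kinf Kt Ll π) in
/-- The invariant cohomology in degree `m` vanishes at `𝔪`. -/
def InvariantVanishing (𝔪 : Ideal (HeckeAlgebra F Kt)) (m : ℕ) : Prop :=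
  ∀ (j : ℕ) (f : (Fin (j + 1) → Γ) → PreCochain ℓ F Kinf m),
    f ∈ EquivariantCochain F Kinf Kt Ll π j m → groupDiff F f = 0 →
    (∀ γ, preDiff F Kinf m (f γ) = 0) →
    ∃ r : FreeAlgebra F (HeckeIndex Kt), toHeckeAlgebra F r ∉ 𝔪 ∧
      IsInvariantCoboundary Kt Ll π fun γ => preAction F Kinf Kt m r (f γ)

omit [Group Γ] in
theorem preAction_groupDiff {j m : ℕ} (r : FreeAlgebra F (HeckeIndex Kt))
    (f : (Fin (j + 1) → Γ) → PreCochain ℓ F Kinf m) :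
    (fun γ => preAction F Kinf Kt m r (groupDiff F f γ)) =
      groupDiff F fun γ => preAction F Kinf Kt m r (f γ) :=
  funext fun γ => map_groupDiff _ f γ

/-- The connecting homomorphism: a coboundary that is invariant is the coboundary of an invariant
cochain after multiplication by an element outside `𝔪`. -/
theorem exists_isInvariantCoboundary (hle : Ll ≤ Kl)
    (hker : ∀ k : Kl.toSubgroup, π k = 1 ↔ (k : GL (Fin n) ℤ_[ℓ]) ∈ Ll)
    {𝔪 : Ideal (HeckeAlgebra F Kt)} {j m : ℕ} (hm : InvariantVanishing F Kinf Kt Ll π 𝔪 m)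
    {f : (Fin (j + 1) → Γ) → PreCochain ℓ F Kinf (m + 1)} (hf0 : groupDiff F f = 0)
    {b : (Fin (j + 1) → Γ) → PreCochain ℓ F Kinf m}
    (hb : b ∈ EquivariantCochain F Kinf Kt Ll π j m) (hbf : ∀ γ, preDiff F Kinf m (b γ) = f γ) :
    ∃ r : FreeAlgebra F (HeckeIndex Kt), toHeckeAlgebra F r ∉ 𝔪 ∧
      IsInvariantCoboundary Kt Ll π fun γ => preAction F Kinf Kt (m + 1) r (f γ) := by
  have hbd : ∀ γ, preDiff F Kinf m (groupDiff F b γ) = 0 := fun γ => by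
    rw [map_groupDiff]
    simp only [hbf]
    exact congrFun hf0 γ
  obtain ⟨r, hr, h⟩ := hm (j + 1) (groupDiff F b) (groupDiff_mem hb) (groupDiff_groupDiff b) hbd
  rw [preAction_groupDiff] at h
  refine ⟨r, hr, ?_⟩
  have hrb := preAction_mem_equivariantCochain r hb
  have hrbf : ∀ γ, preDiff F Kinf m (preAction F Kinf Kt m r (b γ)) =
      preAction F Kinf Kt (m + 1) r (f γ) := fun γ => by rw [preAction_preDiff, hbf]
  cases m with
  | zero => exact ⟨_, hrb, h, hrbf⟩
  | succ m =>
    obtain ⟨w, hw, hw0, hwd⟩ := h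
    obtain ⟨v, hv, rfl⟩ := exists_groupDiff_eq hle hker hw hw0
    -- The `Γ`-differential of `r b` is the coboundary of `w`, the `Γ`-differential of `v`.
    -- Subtracting the coboundary of `v` from `r b` makes it `Γ`-closed without changing its own
    -- coboundary.
    refine ⟨_, Submodule.sub_mem _ hrb (preDiff_mem_equivariantCochain hv), ?_, fun γ => ?_⟩
    · rw [groupDiff_sub, sub_eq_zero]
      funext γ
      rw [← hwd γ, map_groupDiff]
    · rw [Pi.sub_apply, map_sub, hrbf, preDiff_preDiff, sub_zero]

/-- Induction down the staircase of the double complex: a primitive of `f` has its `Γ`-differential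
in bidegree `(j + 1, m - 1)`, where the induction hypothesis applies. Hence `j` must stay arbitrary.
At `m = 0` coboundaries are zero. -/
theorem invariantVanishing (hle : Ll ≤ Kl) (hL : Ll.toSubgroup.Normal)
    (hπ : Function.Surjective π) [Finite Γ]
    (hker : ∀ k : Kl.toSubgroup, π k = 1 ↔ (k : GL (Fin n) ℤ_[ℓ]) ∈ Ll)
    {𝔪 : Ideal (HeckeAlgebra F Kt)} (h𝔪 : 𝔪.IsPrime) {d : ℕ}
    (hvan : ∀ i < d, ∀ x : Coh F Kinf (level Kt Ll) i, VanishesAt Kinf Ll 𝔪 x) {m : ℕ}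
    (hm : m < d) : InvariantVanishing F Kinf Kt Ll π 𝔪 m := by
  induction m with
  | zero =>
    intro j f hf _ hfd
    obtain ⟨r, hr, h⟩ := exists_preAction_mem_coboundary h𝔪 (hvan 0 hm) f
      fun γ => ⟨hf.1 γ, hfd γ⟩
    exact ⟨r, hr, funext h⟩
  | succ m ih =>
    intro j f hf hf0 hfd
    obtain ⟨r, hr, h⟩ := exists_preAction_mem_coboundary h𝔪 (hvan (m + 1) hm) f
      fun γ => ⟨hf.1 γ, hfd γ⟩
    obtain ⟨b, hb, hbf⟩ := exists_preDiff_eq hL hπ hker (preAction_mem_equivariantCochain r hf) h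
    obtain ⟨r', hr', h'⟩ := exists_isInvariantCoboundary hle hker (ih (by omega))
      (by rw [← preAction_groupDiff, hf0]; simp only [Pi.zero_apply, map_zero]; rfl) hb hbf
    refine ⟨r' * r, ?_, ?_⟩
    · rw [map_mul]
      exact fun h => (h𝔪.mem_or_mem h).elim hr' hr
    · simpa only [map_mul, Module.End.mul_apply] using h'

/-- If the cohomology of level `K^ℓ L_ℓ` vanishes at `𝔪` in degrees below `d`, then so does the kernel
of the pull-back map from level `K^ℓ K_ℓ` to level `K^ℓ L_ℓ` in degree `d`. -/
theorem vanishesAt_of_restriction_eq_zero (hle : Ll ≤ Kl) (hL : Ll.toSubgroup.Normal)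
    {𝔪 : Ideal (HeckeAlgebra F Kt)} (h𝔪 : 𝔪.IsPrime) {d : ℕ}
    (hvan : ∀ i < d, ∀ x : Coh F Kinf (level Kt Ll) i, VanishesAt Kinf Ll 𝔪 x)
    (c : Coh F Kinf (level Kt Kl) d) (hc : restriction F Kinf (level_mono Kt hle) d c = 0) :
    VanishesAt Kinf Kl 𝔪 c := by
  obtain ⟨⟨z, hz⟩, rfl⟩ := Submodule.Quotient.mk_surjective _ c
  have hzL : z ∈ Coboundary F Kinf (level Kt Ll) d :=
    (Submodule.Quotient.mk_eq_zero _ (x := (⟨z, _⟩ : Cocycle F Kinf (level Kt Ll) d))).mp hc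
  have hne : toHeckeAlgebra F (1 : FreeAlgebra F (HeckeIndex Kt)) ∉ 𝔪 := by
    rw [map_one]
    exact fun h => h𝔪.ne_top ((Ideal.eq_top_iff_one _).mpr h)
  cases d with
  | zero =>
    refine ⟨1, hne, ?_⟩
    rw [map_one, Module.End.one_apply, Submodule.Quotient.mk_eq_zero]
    exact hzL
  | succ m =>
    have hLK : (Ll.toSubgroup.subgroupOf Kl.toSubgroup).Normal := inferInstance
    let π := QuotientGroup.mk' (Ll.toSubgroup.subgroupOf Kl.toSubgroup)
    have hker : ∀ k : Kl.toSubgroup, π k = 1 ↔ (k : GL (Fin n) ℤ_[ℓ]) ∈ Ll := fun k =>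
      QuotientGroup.eq_one_iff k
    have hπ : Function.Surjective π := QuotientGroup.mk'_surjective _
    have hfin : Finite (Kl.toSubgroup ⧸ Ll.toSubgroup.subgroupOf Kl.toSubgroup) := by
      have := Subgroup.quotient_finite_of_isOpen _ Ll.isOpen
      have : Ll.toSubgroup.FiniteIndex := Subgroup.finiteIndex_of_finite_quotient
      exact Subgroup.finite_quotient_of_finiteIndex
    -- For a constant family, equivariance is exactly invariance of `z` under `K_ℓ`.
    have hconst : (fun _ => z) ∈ EquivariantCochain F Kinf Kt Ll π 0 (m + 1) :=
      ⟨fun _ => ⟨hz.1.1, fun a σ x u hu => hz.1.2 a σ x u (level_mono Kt hle hu)⟩,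
        fun k γ a σ x => (hz.1.2 a σ x _ (placeAt_mem k.2)).symm⟩
    obtain ⟨b, hb, hbz⟩ := exists_preDiff_eq hL hπ hker hconst fun _ => hzL
    obtain ⟨r, hr, b', hb', hb0, hbr⟩ := exists_isInvariantCoboundary hle hker
      (invariantVanishing hle hL hπ hker h𝔪 hvan (Nat.lt_succ_self m))
      (by funext γ; simp [groupDiff, Fin.sum_univ_succ]) hb hbz
    refine ⟨r, hr, (heckeAction_mk_eq_zero r _).mpr
      ⟨b' 1, ⟨(hb'.1 1).1, fun a σ x u hu => ?_⟩, hbr 1⟩⟩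
    obtain ⟨t, ht, k, hk, rfl⟩ := exists_of_mem_level hu
    rw [← mul_assoc, ← hb'.2 ⟨k, hk⟩ 1 a σ, (hb'.1 _).2 a σ x _ (inl_mem ht)]
    rw [apply_eq_of_groupDiff_eq_zero hb0]

/-- An open subgroup of a compact group contains an open normal subgroup. -/
theorem exists_normal_le (Ll : OpenSubgroup (GL (Fin n) ℤ_[ℓ])) :
    ∃ Nl : OpenSubgroup (GL (Fin n) ℤ_[ℓ]), Nl ≤ Ll ∧ Nl.toSubgroup.Normal := by
  have := Subgroup.quotient_finite_of_isOpen _ Ll.isOpen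
  have : Ll.toSubgroup.FiniteIndex := Subgroup.finiteIndex_of_finite_quotient
  exact ⟨⟨Ll.toSubgroup.normalCore, Subgroup.isOpen_of_isClosed_of_finiteIndex _
    (Subgroup.normalCore_isClosed _ Ll.isClosed)⟩, Subgroup.normalCore_le _,
    Subgroup.normalCore_normal _⟩

theorem exists_restriction_eq_zero {d : ℕ} (c : Coh F Kinf (level Kt Kl) d)
    (hc : toLimit F Kinf Kt Kl d c = 0) :
    ∃ (Ll : OpenSubgroup (GL (Fin n) ℤ_[ℓ])) (h : Ll ≤ Kl),
      restriction F Kinf (level_mono Kt h) d c = 0 := by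
  classical
  have : DirectedSystem
      (fun Kl : (OpenSubgroup (GL (Fin n) ℤ_[ℓ]))ᵒᵈ =>
        Coh F Kinf (level Kt (OrderDual.ofDual Kl)) d)
      (fun _ _ h => restriction F Kinf
        (level_mono Kt (OrderDual.ofDual_le_ofDual.mpr h)) d) :=
    ⟨fun _ x => Submodule.Quotient.induction_on _ x fun _ => rfl,
      fun _ _ _ _ _ x => Submodule.Quotient.induction_on _ x fun _ => rfl⟩
  obtain ⟨Ll, h, h0⟩ := Module.DirectLimit.of.zero_exact hc
  exact ⟨OrderDual.ofDual Ll, h, h0⟩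

theorem vanishesAt_of_toLimit_eq_zero {𝔪 : Ideal (HeckeAlgebra F Kt)} (h𝔪 : 𝔪.IsPrime) {d : ℕ}
    (hvan : ∀ i < d, ∀ Ll : OpenSubgroup (GL (Fin n) ℤ_[ℓ]), Ll.toSubgroup.Normal →
      ∀ x : Coh F Kinf (level Kt Ll) i, VanishesAt Kinf Ll 𝔪 x)
    (c : Coh F Kinf (level Kt Kl) d) (hc : toLimit F Kinf Kt Kl d c = 0) :
    VanishesAt Kinf Kl 𝔪 c := by
  obtain ⟨Ll, hLK, h⟩ := exists_restriction_eq_zero c hc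
  obtain ⟨Nl, hNL, hN⟩ := exists_normal_le Ll
  refine vanishesAt_of_restriction_eq_zero (hNL.trans hLK) hN h𝔪
    (fun i hi x => hvan i hi Nl hN x) c ?_
  have : restriction F Kinf (level_mono Kt (hNL.trans hLK)) d c =
      restriction F Kinf (level_mono Kt hNL) d (restriction F Kinf (level_mono Kt hLK) d c) :=
    Submodule.Quotient.induction_on _ c fun _ => rfl
  rw [this, h, map_zero]

end HochschildSerre


/-! ### Eigenclasses of Eisenstein ideals -/

section EisensteinAlgebra

variable {F I A V : Type*} [Field F] [CommGroup A] [AddCommGroup V] [Module F V]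

/-- An eigenvector of an ideal that contains `T - deg(T)` for all monomials `T` with `⟨T⟩ = 1`
extends to a family `⟨a⟩ c` with `T ⟨a⟩ c = deg(T) ⟨a ⟨T⟩⟩ c`. -/
theorem exists_twist_family (𝔪 : Ideal (MvPolynomial I F)) (h𝔪 : 𝔪.IsPrime) (cl : I → A)
    (deg : I → F) (hcl : ∀ s, IsOfFinOrder (cl s))
    (hEis : ∀ w : I →₀ ℕ, (w.prod fun s e => cl s ^ e) = 1 →
      MvPolynomial.monomial w (1 : F) - MvPolynomial.C (w.prod fun s e => deg s ^ e) ∈ 𝔪)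
    (E : MvPolynomial I F →ₗ[F] V) (hE : ∀ t ∈ 𝔪, E t = 0) (op : I → Module.End F V)
    (hop : ∀ s t, op s (E t) = E (MvPolynomial.X s * t)) :
    ∃ v : A → V, v 1 = E 1 ∧ ∀ s a, op s (v a) = deg s • v (a * cl s) := by
  classical
  let D : (I →₀ ℕ) → F := fun w => w.prod fun s e => deg s ^ e
  let K : (I →₀ ℕ) → A := fun w => w.prod fun s e => cl s ^ e
  let X : (I →₀ ℕ) → MvPolynomial I F := fun w => MvPolynomial.monomial w 1
  have D0 : D 0 = 1 := Finsupp.prod_zero_index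
  have K0 : K 0 = 1 := Finsupp.prod_zero_index
  have Dadd : ∀ w w', D (w + w') = D w * D w' := fun w w' =>
    Finsupp.prod_add_index' (by simp) fun _ _ _ => pow_add _ _ _
  have Kadd : ∀ w w', K (w + w') = K w * K w' := fun w w' =>
    Finsupp.prod_add_index' (by simp) fun _ _ _ => pow_add _ _ _
  have Dsingle : ∀ s e, D (Finsupp.single s e) = deg s ^ e := fun s e =>
    Finsupp.prod_single_index (pow_zero _)
  have Ksingle : ∀ s e, K (Finsupp.single s e) = cl s ^ e := fun s e =>
    Finsupp.prod_single_index (pow_zero _)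
  have Xadd : ∀ w w', X (w + w') = X w * X w' := fun w w' => by
    simp [X, MvPolynomial.monomial_mul]
  have Xsingle : ∀ s, X (Finsupp.single s 1) = MvPolynomial.X s := fun s => rfl
  have hEis' : ∀ w, K w = 1 → X w - MvPolynomial.C (D w) ∈ 𝔪 := hEis
  have hconst : ∀ r : F, MvPolynomial.C r ∈ 𝔪 → r = 0 := fun r hr => by
    by_contra h
    exact h𝔪.ne_top (Ideal.eq_top_of_isUnit_mem _ hr ((IsUnit.mk0 r h).map MvPolynomial.C))
  have Kfin : ∀ w, IsOfFinOrder (K w) := fun w =>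
    (CommGroup.mem_torsion _).mp
      (Subgroup.prod_mem _ fun s _ => (CommGroup.mem_torsion _).mpr (hcl s).pow)
  have hinv : ∀ w, D w ≠ 0 → ∃ z, D z ≠ 0 ∧ K z * K w = 1 := fun w hw => by
    obtain ⟨N, hN, h⟩ := isOfFinOrder_iff_pow_eq_one.mp (Kfin w)
    have key : ∀ N : ℕ, D (N • w) = D w ^ N ∧ K (N • w) = K w ^ N := fun N => by
      induction N with
      | zero => simp [D0, K0]
      | succ N ih => simp [succ_nsmul, Dadd, Kadd, ih, pow_succ]
    refine ⟨(N - 1) • w, ?_, ?_⟩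
    · rw [(key _).1]
      exact pow_ne_zero _ hw
    · rw [(key _).2, ← pow_succ, Nat.sub_add_cancel hN, h]
  -- With `z` inverse to `w` in class, the two relations for `z + w` and `z + w'` combine to put `X
  -- z * (D w' X w - D w X w')` in `𝔪`. The factor `X z` is outside `𝔪`, since `X z * X w` is a
  -- nonzero constant modulo `𝔪`.
  have hwd : ∀ w w', D w ≠ 0 → D w' ≠ 0 → K w = K w' →
      (D w)⁻¹ • E (X w) = (D w')⁻¹ • E (X w') := fun w w' hw hw' hK => by
    obtain ⟨z, hz, hzw⟩ := hinv w hw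
    have h1 := hEis' (z + w) (by rw [Kadd, hzw])
    have h2 := hEis' (z + w') (by rw [Kadd, ← hK, hzw])
    rw [Xadd, Dadd, map_mul] at h1 h2
    have h3 : X z * (MvPolynomial.C (D w') * X w - MvPolynomial.C (D w) * X w') ∈ 𝔪 := by
      have := 𝔪.sub_mem (𝔪.mul_mem_left (MvPolynomial.C (D w')) h1)
        (𝔪.mul_mem_left (MvPolynomial.C (D w)) h2)
      convert this using 1
      ring
    have h4 : X z ∉ 𝔪 := fun h => by
      have := 𝔪.sub_mem (𝔪.mul_mem_right (X w) h) h1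
      rw [sub_sub_cancel, ← map_mul] at this
      exact mul_ne_zero hz hw (hconst _ this)
    have h5 := hE _ ((h𝔪.mem_or_mem h3).resolve_left h4)
    rw [map_sub, ← MvPolynomial.smul_eq_C_mul, ← MvPolynomial.smul_eq_C_mul, map_smul, map_smul,
      sub_eq_zero] at h5
    rw [inv_smul_eq_iff₀ hw, smul_comm, ← h5, inv_smul_smul₀ hw']
  -- Degrees may vanish in `F`, so some `a` need not be reached by a monomial of nonzero degree; the
  -- value `0` there is consistent with the relations, as checked below.
  let v : A → V := fun a =>
    if h : ∃ w, D w ≠ 0 ∧ K w = a then (D h.choose)⁻¹ • E (X h.choose) else 0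
  have v_eq : ∀ w, D w ≠ 0 → v (K w) = (D w)⁻¹ • E (X w) := fun w hw => by
    have h : ∃ w', D w' ≠ 0 ∧ K w' = K w := ⟨w, hw, rfl⟩
    simp only [v, dif_pos h]
    exact hwd _ _ h.choose_spec.1 hw h.choose_spec.2
  have v_zero : ∀ a, (¬ ∃ w, D w ≠ 0 ∧ K w = a) → v a = 0 := fun a h => dif_neg h
  refine ⟨v, ?_, fun s a => ?_⟩
  · have h := v_eq 0 (by rw [D0]; exact one_ne_zero)
    rw [K0, D0, inv_one, one_smul] at h
    exact h
  · by_cases hs : deg s = 0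
    · have hX : MvPolynomial.X s ∈ 𝔪 := by
        obtain ⟨N, hN, h⟩ := isOfFinOrder_iff_pow_eq_one.mp (hcl s)
        have h1 := hEis' (Finsupp.single s N) (by rw [Ksingle, h])
        rw [Dsingle, hs, zero_pow hN.ne', map_zero, sub_zero] at h1
        refine h𝔪.mem_of_pow_mem N ?_
        rwa [MvPolynomial.X_pow_eq_monomial]
      rw [hs, zero_smul]
      by_cases ha : ∃ w, D w ≠ 0 ∧ K w = a
      · obtain ⟨w, hw, rfl⟩ := ha
        rw [v_eq w hw, map_smul, hop, hE _ (𝔪.mul_mem_right _ hX), smul_zero]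
      · rw [v_zero a ha, map_zero]
    · have hDs : D (Finsupp.single s 1) ≠ 0 := by rwa [Dsingle, pow_one]
      by_cases ha : ∃ w, D w ≠ 0 ∧ K w = a
      · obtain ⟨w, hw, rfl⟩ := ha
        have h := v_eq (Finsupp.single s 1 + w) (by rw [Dadd]; exact mul_ne_zero hDs hw)
        rw [Kadd, Dadd, Ksingle, Dsingle, pow_one, pow_one, mul_comm, Xadd, Xsingle, ← hop] at h
        rw [h, v_eq w hw, map_smul, smul_smul, mul_inv, mul_inv_cancel_left₀ hs]
      · rw [v_zero a ha, v_zero, map_zero, smul_zero]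
        -- The set of reached classes is stable under multiplication by the inverse of `cl s`, so if
        -- `a * cl s` were reached, `a` would be too.
        rintro ⟨w, hw, hK⟩
        obtain ⟨z, hz, hzs⟩ := hinv _ hDs
        refine ha ⟨w + z, by rw [Dadd]; exact mul_ne_zero hw hz, ?_⟩
        rw [Ksingle, pow_one] at hzs
        rw [Kadd, hK, mul_assoc, mul_comm (cl s), hzs, mul_one]

end EisensteinAlgebra

/-! ### Finite order of Hecke determinants in the component group -/

section Components

/-- An element of a compact group has a positive power in a given open subgroup. -/
theorem exists_pow_map_mem {G H : Type*} [Group G] [TopologicalSpace G] [IsTopologicalGroup G]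
    [CompactSpace G] [Group H] [TopologicalSpace H] (φ : G →* H) (hφ : Continuous φ)
    (U : Subgroup H) (hU : IsOpen (U : Set H)) (g : G) : ∃ N, 0 < N ∧ φ g ^ N ∈ U := by
  have : Finite (G ⧸ U.comap φ) := Subgroup.quotient_finite_of_isOpen _ (hU.preimage hφ)
  have : (U.comap φ).FiniteIndex := Subgroup.finiteIndex_of_finite_quotient
  obtain ⟨N, hN, -, h⟩ := Subgroup.exists_pow_mem_of_index_ne_zero
    (Subgroup.FiniteIndex.index_ne_zero (H := U.comap φ)) g
  exact ⟨N, hN, by simpa using h⟩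

/-- The diagonal matrix with the entry `u` at the index `i`, and `1` elsewhere. -/
def diagonalAt {n : ℕ} (R : Type*) [CommRing R] (i : Fin n) : Rˣ →* GL (Fin n) R :=
  Units.map ((Matrix.diagonalRingHom (Fin n) R).toMonoidHom.comp
    (MonoidHom.mulSingle (fun _ => R) i))

theorem det_diagonalAt {n : ℕ} {R : Type*} [CommRing R] (i : Fin n) (u : Rˣ) :
    Matrix.GeneralLinearGroup.det (diagonalAt R i u) = u := by
  ext
  simp [diagonalAt, Matrix.det_diagonal]

theorem continuous_diagonalAt {n : ℕ} {R : Type*} [CommRing R] [TopologicalSpace R] (i : Fin n) :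
    Continuous (diagonalAt R i) := by
  refine Continuous.units_map _ ?_
  exact Continuous.matrix_diagonal (continuous_mulSingle (A := fun _ : Fin n => R) i)

variable {n ℓ : ℕ} [Fact ℓ.Prime]

/-- The inclusion of the product of the `ℤ_q`, `q ≠ ℓ`, into `𝔸^{ℓ,∞}`. -/
def integralAdeles (ℓ : ℕ) : (∀ q : AwayPrime ℓ, PadicInt.subring (q : ℕ)) →* AwayAdele ℓ where
  toFun := RestrictedProduct.structureMap _ _ _
  map_one' := rfl
  map_mul' _ _ := rfl

instance compactSpace_subring (q : ℕ) [Fact q.Prime] : CompactSpace (PadicInt.subring q) :=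
  inferInstanceAs (CompactSpace ℤ_[q])

omit [Fact ℓ.Prime] in
/-- An idele in `𝔸^{ℓ,∞}` whose components all have norm one is a unit of the integral adeles. -/
theorem exists_integralAdeles_eq (w : (AwayAdele ℓ)ˣ)
    (hw : ∀ q : AwayPrime ℓ, ‖(w : AwayAdele ℓ) q‖ = 1) :
    ∃ u, Units.map (integralAdeles ℓ) u = w := by
  have h : ∀ q : AwayPrime ℓ, (w : AwayAdele ℓ) q * ((w⁻¹ : (AwayAdele ℓ)ˣ) : AwayAdele ℓ) q = 1 :=
    fun q => congrArg (fun x : AwayAdele ℓ => x q) w.mul_inv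
  have hw' : ∀ q : AwayPrime ℓ, ‖((w⁻¹ : (AwayAdele ℓ)ˣ) : AwayAdele ℓ) q‖ = 1 := fun q => by
    have := congrArg norm (h q)
    rwa [norm_mul, hw, one_mul, norm_one] at this
  refine ⟨⟨fun q => ⟨(w : AwayAdele ℓ) q, (hw q).le⟩,
    fun q => ⟨((w⁻¹ : (AwayAdele ℓ)ˣ) : AwayAdele ℓ) q, (hw' q).le⟩, ?_, ?_⟩, ?_⟩
  · funext q
    exact Subtype.ext (h q)
  · funext q
    exact Subtype.ext ((mul_comm _ _).trans (h q))
  · ext q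
    rfl

/-- The idele `ϖ_q` is the product of the rational number `q` and a unit idele. -/
theorem exists_uniformizerAt_eq (q : AwayPrime ℓ) :
    ∃ (r : ℚˣ) (u : (∀ q : AwayPrime ℓ, PadicInt.subring (q : ℕ))ˣ) (v : ℤ_[ℓ]ˣ),
      r ∈ Units.posSubgroup ℚ ∧ (uniformizerAt q, 1) = rationalIdele ℓ r *
        (Units.map (integralAdeles ℓ) u, Units.map (algebraMap ℤ_[ℓ] ℚ_[ℓ]).toMonoidHom v) := by
  have hq : ((q : ℕ) : ℚ) ≠ 0 := Nat.cast_ne_zero.mpr q.2.1.ne_zero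
  let r : ℚˣ := Units.mk0 ((q : ℕ) : ℚ) hq
  have hnorm : ∀ p : ℕ, [Fact p.Prime] → p ≠ q → ‖((q : ℕ) : ℚ_[p])‖ = 1 := fun p hp hpq =>
    Padic.norm_natCast_eq_one_iff.mpr ((Nat.coprime_primes hp.out q.2.1).mpr hpq)
  obtain ⟨u, hu⟩ := exists_integralAdeles_eq
    ((Units.map (ratToAway ℓ).toMonoidHom r)⁻¹ * uniformizerAt q) fun q' => by
      have h1 : ((Units.map (ratToAway ℓ).toMonoidHom r : (AwayAdele ℓ)ˣ) : AwayAdele ℓ) *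
          (((Units.map (ratToAway ℓ).toMonoidHom r)⁻¹ * uniformizerAt q : (AwayAdele ℓ)ˣ) :
            AwayAdele ℓ) = uniformizerAt q := by
        rw [← Units.val_mul, mul_inv_cancel_left]
      have h2 := congrArg (fun x : AwayAdele ℓ => ‖x q'‖) h1
      have h3 : ((Units.map (ratToAway ℓ).toMonoidHom r : (AwayAdele ℓ)ˣ) : AwayAdele ℓ) q' =
          ((q : ℕ) : ℚ_[(q' : ℕ)]) := Rat.cast_natCast _
      simp only [RestrictedProduct.mul_apply, norm_mul, h3] at h2
      have h4 : ((uniformizerAt q : (AwayAdele ℓ)ˣ) : AwayAdele ℓ) =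
        RestrictedProduct.mulSingle (fun q : AwayPrime ℓ => PadicInt.subring (q : ℕ)) q
          ((q : ℕ) : ℚ_[(q : ℕ)]) := rfl
      rw [h4] at h2
      by_cases hqq : q' = q
      · subst hqq
        rw [RestrictedProduct.mulSingle_eq_same] at h2
        refine mul_left_cancel₀ (norm_ne_zero_iff.mpr ?_) (h2.trans (mul_one _).symm)
        exact Nat.cast_ne_zero.mpr q'.2.1.ne_zero
      · rw [RestrictedProduct.mulSingle_eq_of_ne _ _ hqq,
          hnorm q' fun h => hqq (Subtype.ext h), one_mul, norm_one] at h2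
        exact h2
  have hv : IsUnit (((q : ℕ) : ℤ_[ℓ])) := PadicInt.isUnit_iff.mpr <| by
    rw [PadicInt.norm_def, PadicInt.coe_natCast]
    exact hnorm ℓ q.2.2.symm
  -- At `ℓ` the rational number `q` has component `q` and the left side has component `1`, whence
  -- the inverse of the unit `q`.
  refine ⟨r, u, hv.unit⁻¹, ?_, Prod.ext ?_ ?_⟩
  · exact Units.mem_posSubgroup _ |>.mpr (Nat.cast_pos.mpr q.2.1.pos)
  · rw [Prod.fst_mul, hu]
    exact (mul_inv_cancel_left _ _).symm
  · rw [Prod.snd_mul, map_inv, eq_mul_inv_iff_mul_eq, one_mul]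
    ext1
    change algebraMap ℤ_[ℓ] ℚ_[ℓ] ((q : ℕ) : ℤ_[ℓ]) = algebraMap ℚ ℚ_[ℓ] ((q : ℕ) : ℚ)
    rw [map_natCast, map_natCast]

/-- Modulo positive rationals the idele is an integral unit. Lifted to a diagonal matrix with that
determinant, it has a power in the open subgroup `K^ℓ K_ℓ` by compactness. The exponents `N` away
from `ℓ` and `M` at `ℓ` are found separately, and `N * M` serves both. -/
theorem isOfFinOrder_uniformizerAt (hn : 0 < n) (Kt : TameLevel n ℓ)
    (Kl : OpenSubgroup (GL (Fin n) ℤ_[ℓ])) (q : AwayPrime ℓ) :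
    IsOfFinOrder (QuotientGroup.mk (uniformizerAt q, 1) : ComponentGroup Kt Kl) := by
  obtain ⟨r, u, v, hr, h⟩ := exists_uniformizerAt_eq q
  let i : Fin n := ⟨0, hn⟩
  obtain ⟨N, hN, hu⟩ := exists_pow_map_mem
    ((diagonalAt (AwayAdele ℓ) i).comp (Units.map (integralAdeles ℓ)))
    ((continuous_diagonalAt i).comp (Continuous.units_map _
      RestrictedProduct.isEmbedding_structureMap.continuous)) Kt.toSubgroup Kt.isOpen' u
  obtain ⟨M, hM, hv⟩ := exists_pow_map_mem (diagonalAt ℤ_[ℓ] i) (continuous_diagonalAt i)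
    Kl.toSubgroup Kl.isOpen v
  refine isOfFinOrder_iff_pow_eq_one.mpr ⟨N * M, Nat.mul_pos hN hM, ?_⟩
  rw [← QuotientGroup.mk_pow, QuotientGroup.eq_one_iff, h, mul_pow, ← map_pow]
  refine mul_mem (Subgroup.mem_sup_left (Subgroup.mem_map_of_mem _ (pow_mem hr _)))
    (Subgroup.mem_sup_right ⟨(diagonalAt (AwayAdele ℓ) i (Units.map (integralAdeles ℓ) u),
      integralPoints n ℓ (diagonalAt ℤ_[ℓ] i v)) ^ (N * M), ?_, ?_⟩)
  · refine Subgroup.mem_prod.mpr ⟨?_, ?_⟩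
    · rw [Prod.pow_fst, pow_mul]
      exact pow_mem hu M
    · rw [Prod.pow_snd, ← map_pow]
      refine Subgroup.mem_map_of_mem _ ?_
      rw [mul_comm, pow_mul]
      exact pow_mem hv N
  · rw [map_pow]
    congr 1
    refine Prod.ext (det_diagonalAt _ _) ?_
    change Matrix.GeneralLinearGroup.det (Matrix.GeneralLinearGroup.map _ _) = _
    rw [Matrix.GeneralLinearGroup.map_det, det_diagonalAt]
    rfl

theorem isOfFinOrder_componentClass {Kt : TameLevel n ℓ} (Kl : OpenSubgroup (GL (Fin n) ℤ_[ℓ]))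
    (s : HeckeIndex Kt) : IsOfFinOrder (componentClass Kl s) := by
  have h : adelicDet n ℓ (s.matrix, 1) =
      (uniformizerAt s.1.1, 1) ^ (Finset.univ.filter fun i : Fin n => (i : ℕ) < s.2 + 1).card := by
    refine Prod.ext ?_ (by simp [adelicDet])
    rw [Prod.pow_fst, ← Finset.prod_const, Finset.prod_filter]
    ext1
    rw [Units.coe_prod]
    exact (Matrix.det_diagonal).trans rfl
  rw [componentClass, h, QuotientGroup.mk_pow]
  exact (isOfFinOrder_uniformizerAt s.2.pos Kt Kl s.1.1).pow

end Components

/-! ### From eigenclasses to Eisenstein classes -/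

section Eisenstein

variable {n ℓ : ℕ} [Fact ℓ.Prime] {F : Type*} [Field F] {Kinf : Subgroup (GL (Fin n) ℝ)}
  {Kt : TameLevel n ℓ} {Kl : OpenSubgroup (GL (Fin n) ℤ_[ℓ])} {𝔪 : Ideal (HeckeAlgebra F Kt)}
  {i : ℕ} {c : Coh F Kinf (level Kt Kl) i}

omit [Fact ℓ.Prime] in
theorem toHeckeAlgebra_surjective :
    Function.Surjective (toHeckeAlgebra F : FreeAlgebra F (HeckeIndex Kt) →ₐ[F] _) := by
  rw [← AlgHom.range_eq_top, eq_top_iff, ← MvPolynomial.adjoin_range_X, Algebra.adjoin_le_iff]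
  rintro _ ⟨s, rfl⟩
  exact ⟨FreeAlgebra.ι F s, FreeAlgebra.lift_ι_apply _ _⟩

/-- An eigenclass that vanishes in the localisation is zero. -/
theorem IsEigenclass.eq_zero (h𝔪 : 𝔪.IsMaximal) (h : IsEigenclass Kinf Kl 𝔪 c)
    (hv : VanishesAt Kinf Kl 𝔪 c) : c = 0 := by
  obtain ⟨r, hr, hrc⟩ := hv
  -- Invert `r` modulo `𝔪`: then `1 - t r` lies in `𝔪` and kills `c`, while `r` kills `c` as well.
  obtain ⟨t, m, hm, htm⟩ := h𝔪.exists_inv hr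
  obtain ⟨t, rfl⟩ := toHeckeAlgebra_surjective t
  have h1 := h (1 - t * r) (by
    rw [map_sub, map_mul, map_one, ← htm, add_sub_cancel_left]
    exact hm)
  rw [map_sub, map_mul, map_one, LinearMap.sub_apply, Module.End.mul_apply, hrc, map_zero,
    sub_zero] at h1
  exact h1

theorem IsEigenclass.isEisensteinClass (h𝔪 : 𝔪.IsPrime) (hE : IsEisensteinIdeal Kl 𝔪)
    (h : IsEigenclass Kinf Kl 𝔪 c) : IsEisensteinClass Kinf Kl c := by
  let ρ : FreeAlgebra F (HeckeIndex Kt) →ₗ[F] Coh F Kinf (level Kt Kl) i :=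
    (LinearMap.applyₗ c).comp (heckeAction F Kinf Kl i).toLinearMap
  let e := LinearMap.quotKerEquivOfSurjective
    (toHeckeAlgebra F : FreeAlgebra F (HeckeIndex Kt) →ₐ[F] _).toLinearMap
    toHeckeAlgebra_surjective
  -- The orbit map `T ↦ T c` descends from the free algebra to `𝐓` because a lift of `0 ∈ 𝔪` already
  -- kills the eigenclass `c`.
  let E : HeckeAlgebra F Kt →ₗ[F] Coh F Kinf (level Kt Kl) i :=
    (Submodule.liftQ _ ρ fun r hr => h r (by
      have h0 : toHeckeAlgebra F r = 0 := hr
      rw [h0]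
      exact 𝔪.zero_mem)).comp e.symm.toLinearMap
  have hEr : ∀ r, E (toHeckeAlgebra F r) = heckeAction F Kinf Kl i r c := fun r => by
    have : e.symm (toHeckeAlgebra F r) = Submodule.Quotient.mk r := by
      rw [LinearEquiv.symm_apply_eq]
      rfl
    simp only [E, LinearMap.comp_apply, LinearEquiv.coe_coe, this]
    rfl
  obtain ⟨v, hv1, hv⟩ := exists_twist_family 𝔪 h𝔪 (componentClass Kl)
    (fun s => (Kt.heckeDegree s.matrix : F)) (isOfFinOrder_componentClass Kl)
    (fun w hw => by
      have := hE w hw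
      simpa only [Finsupp.prod, Nat.cast_prod, Nat.cast_pow] using this) E
    (fun t ht => by
      obtain ⟨r, rfl⟩ := toHeckeAlgebra_surjective t
      rw [hEr]
      exact h r ht)
    (fun s => hecke F Kinf Kt Kl s.matrix i) (fun s t => by
      obtain ⟨r, rfl⟩ := toHeckeAlgebra_surjective t
      have : (MvPolynomial.X s : HeckeAlgebra F Kt) = toHeckeAlgebra F (FreeAlgebra.ι F s) :=
        (FreeAlgebra.lift_ι_apply _ _).symm
      have hs : heckeAction F Kinf Kl i (FreeAlgebra.ι F s) = hecke F Kinf Kt Kl s.matrix i :=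
        FreeAlgebra.lift_ι_apply _ _
      have hm := hEr (FreeAlgebra.ι F s * r)
      rw [map_mul, map_mul (heckeAction F Kinf Kl i), Module.End.mul_apply, hs] at hm
      rw [this, hm, hEr])
  have h0 : toHeckeAlgebra F (1 : FreeAlgebra F (HeckeIndex Kt)) = 1 := map_one _
  have h1 := hEr 1
  rw [h0, map_one (heckeAction F Kinf Kl i), Module.End.one_apply] at h1
  exact ⟨v, hv1.trans h1, hv⟩

end Eisenstein

end ArithCohomology

end

theorem mainTheorem9 (n : ℕ) (hn : 1 ≤ n) (ℓ p : ℕ) [Fact ℓ.Prime] [Fact p.Prime] (hpℓ : p ≠ ℓ)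
    (F : Type*) [Field F] [Finite F] [CharP F p]
    (Kinf : Subgroup (GL (Fin n) ℝ))
    (hKinf : Maximal (fun H : Subgroup (GL (Fin n) ℝ) => IsCompact (H : Set (GL (Fin n) ℝ))) Kinf)
    (Kt : ArithCohomology.TameLevel n ℓ) (Kl : OpenSubgroup (GL (Fin n) ℤ_[ℓ])) (d : ℕ)
    (𝔪 : Ideal (ArithCohomology.HeckeAlgebra F Kt)) (h𝔪 : 𝔪.IsMaximal)
    (hvan : ¬ ArithCohomology.IsEisensteinIdeal Kl 𝔪 →
      ∀ i < d, ∀ Ll : OpenSubgroup (GL (Fin n) ℤ_[ℓ]),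
        (Ll : Subgroup (GL (Fin n) ℤ_[ℓ])).Normal →
          ∀ x : ArithCohomology.Coh F Kinf (ArithCohomology.level Kt Ll) i,
            ArithCohomology.VanishesAt Kinf Ll 𝔪 x)
    (c : ArithCohomology.Coh F Kinf (ArithCohomology.level Kt Kl) d)
    (hc : ArithCohomology.toLimit F Kinf Kt Kl d c = 0) :
    (¬ ArithCohomology.IsEisensteinIdeal Kl 𝔪 → ArithCohomology.VanishesAt Kinf Kl 𝔪 c) ∧
      (ArithCohomology.IsEigenclass Kinf Kl 𝔪 c →
        ArithCohomology.IsEisensteinClass Kinf Kl c) := by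
  have hprime : 𝔪.IsPrime := h𝔪.isPrime
  refine ⟨fun hE => ArithCohomology.vanishesAt_of_toLimit_eq_zero hprime (hvan hE) c hc,
    fun hc' => ?_⟩
  -- Only the non-Eisenstein case uses that `c` dies in the limit; there `c = 0`, and the zero
  -- family witnesses the claim.
  by_cases hE : ArithCohomology.IsEisensteinIdeal Kl 𝔪
  · exact hc'.isEisensteinClass hprime hE
  · have h0 : c = 0 := hc'.eq_zero h𝔪
      (ArithCohomology.vanishesAt_of_toLimit_eq_zero hprime (hvan hE) c hc)
    exact ⟨0, h0.symm, fun s a => by simp⟩
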